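/- Let $0\le a<1$ and let $(a_j)_{j\ge 2}$ be i.i.d. random variables, each uniformly distributed on $[a,1]$. For $N\ge 1$ let $H_N$ be the real symmetric tridiagonal $N\times N$ matrix with all diagonal entries equal to $2$, with entries $-a_n$ at the positions $(n-1,n)$ and $(n,n-1)$ for $n=2,\dots,N$, and with all other entries $0$. Let $\lambda_N$ be the smallest eigenvalue of $H_N$, let $u_N=H_N^{-1}\mathbb 1\in\mathbb R^N$ be its landscape function, where $\mathbb 1=(1,\dots,1)$, let $\|u_N\|_\infty=\max_{1\le n\le N}|u_N(n)|$, and let $$T_N=\frac{\log N}{2\log\log N}.$$ Then $$\lim_{N\to\infty}\frac{\|u_N\|_\infty}{T_N^2}=\frac18\quad\text{almost surely},$$ $$8\le\liminf_{N\to\infty}\lambda_N T_N^2\le\limsup_{N\to\infty}\lambda_N T_N^2\le\pi^2\quad\text{almost surely},$$ and consequently $$1\le\liminf_{N\to\infty}\lambda_N\|u_N\|_\infty\le\limsup_{N\to\infty}\lambda_N\|u_N\|_\infty\le\frac{\pi^2}{8}\quad\text{almost surely}.$$ -/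

import Mathlib

open MeasureTheory ProbabilityTheory Filter Topology

noncomputable section

/-- The `N × N` nearest-neighbour hopping matrix: diagonal entries `2`, and, with rows and columns
labelled `1, …, N`, entries `-a n` at the positions `(n - 1, n)` and `(n, n - 1)` for `2 ≤ n ≤ N`.
The index `i : Fin N` stands for the label `i + 1`. -/
def hoppingMatrix (a : ℕ → ℝ) (N : ℕ) : Matrix (Fin N) (Fin N) ℝ :=
  Matrix.of fun i j =>
    if i = j then 2
    else if (j : ℕ) = (i : ℕ) + 1 then -a ((j : ℕ) + 1)
    else if (i : ℕ) = (j : ℕ) + 1 then -a ((i : ℕ) + 1)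
    else 0

/-- The ground state energy: the smallest eigenvalue of the hopping matrix. -/
def groundEnergy (a : ℕ → ℝ) (N : ℕ) : ℝ :=
  sInf {μ : ℝ | Module.End.HasEigenvalue (Matrix.toLin' (hoppingMatrix a N)) μ}

/-- The landscape function `u = H⁻¹ 𝟙`. On `Fin N → ℝ` the norm `‖u‖` is the `ℓ^∞` norm. -/
def landscape (a : ℕ → ℝ) (N : ℕ) : Fin N → ℝ :=
  Matrix.mulVec (hoppingMatrix a N)⁻¹ (fun _ => 1)

/-- The length scale `T_N = log N / (2 log log N)`. -/
def lengthScale (N : ℕ) : ℝ :=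
  Real.log N / (2 * Real.log (Real.log N))

end

/-- For hopping terms in `[0, 1]` the hopping matrix is invertible, so that `landscape` uses a
genuine inverse. -/
theorem hoppingMatrix_isUnit_det (a : ℕ → ℝ) (N : ℕ)
    (ha : ∀ j, 2 ≤ j → a j ∈ Set.Icc (0 : ℝ) 1) : IsUnit (hoppingMatrix a N).det := by
  rw [isUnit_iff_ne_zero]
  intro hdet
  obtain ⟨v, hv0, hv⟩ := Matrix.exists_mulVec_eq_zero_iff.mpr hdet
  obtain ⟨k, hk⟩ := Function.ne_iff.mp hv0
  have hne : (Finset.univ : Finset (Fin N)).Nonempty := ⟨k, Finset.mem_univ k⟩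
  obtain ⟨m, -, hm⟩ := Finset.exists_max_image Finset.univ (fun i => |v i|) hne
  obtain ⟨i, hi, himin⟩ := Finset.exists_min_image
    (Finset.univ.filter fun i => |v i| = |v m|) (fun i : Fin N => (i : ℕ)) ⟨m, by simp⟩
  simp only [Finset.mem_filter, Finset.mem_univ, true_and] at hi himin
  have hM : 0 < |v i| := by
    rw [hi]
    exact lt_of_lt_of_le (abs_pos.mpr hk) (hm k (Finset.mem_univ k))
  have hmax : ∀ j, |v j| ≤ |v i| := fun j => hi ▸ hm j (Finset.mem_univ j)
  have hrow : ∑ j, hoppingMatrix a N i j * v j = 0 := congrFun hv i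
  rw [← Finset.add_sum_erase _ _ (Finset.mem_univ i)] at hrow
  have hii : hoppingMatrix a N i i = 2 := by simp [hoppingMatrix]
  rw [hii] at hrow
  have h1 : 2 * |v i| ≤ ∑ j ∈ Finset.univ.erase i, |hoppingMatrix a N i j * v j| := by
    have : 2 * v i = -∑ j ∈ Finset.univ.erase i, hoppingMatrix a N i j * v j := by linarith
    calc 2 * |v i| = |2 * v i| := by rw [abs_mul]; norm_num
      _ ≤ _ := by rw [this, abs_neg]; exact Finset.abs_sum_le_sum_abs _ _
  have h2 : ∑ j ∈ Finset.univ.erase i, |hoppingMatrix a N i j * v j| ≤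
      ∑ j : Fin N, ((if (j : ℕ) = (i : ℕ) + 1 then |v j| else 0) +
        (if (i : ℕ) = (j : ℕ) + 1 then |v j| else 0)) := by
    refine (Finset.sum_le_sum fun j hj => ?_).trans
      (Finset.sum_le_sum_of_subset_of_nonneg (Finset.erase_subset i _) fun j _ _ => by positivity)
    have hji : i ≠ j := (Finset.ne_of_mem_erase hj).symm
    have key : ∀ n, 2 ≤ n → |a n * v j| ≤ |v j| := fun n hn => by
      rw [abs_mul, abs_of_nonneg (ha n hn).1]
      exact mul_le_of_le_one_left (abs_nonneg _) (ha n hn).2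
    simp only [hoppingMatrix, Matrix.of_apply, hji, if_false]
    by_cases c1 : (j : ℕ) = (i : ℕ) + 1
    · have c2 : ¬ (i : ℕ) = (j : ℕ) + 1 := by omega
      rw [if_pos c1, if_pos c1, if_neg c2, neg_mul, abs_neg, add_zero]
      exact key _ (by omega)
    · by_cases c2 : (i : ℕ) = (j : ℕ) + 1
      · rw [if_neg c1, if_pos c2, if_neg c1, if_pos c2, neg_mul, abs_neg, zero_add]
        exact key _ (by omega)
      · simp [c1, c2]
  rw [Finset.sum_add_distrib] at h2
  have h3 : ∑ j : Fin N, (if (j : ℕ) = (i : ℕ) + 1 then |v j| else 0) ≤ |v i| := by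
    by_cases h : (i : ℕ) + 1 < N
    · rw [Finset.sum_eq_single (⟨(i : ℕ) + 1, h⟩ : Fin N)]
      · simpa using hmax _
      · intro j _ hj
        exact if_neg fun hc => hj (Fin.ext hc)
      · simp
    · rw [Finset.sum_eq_zero]
      · exact hM.le
      · intro j _
        exact if_neg (by have := j.2; omega)
  have h4 : ∑ j : Fin N, (if (i : ℕ) = (j : ℕ) + 1 then |v j| else 0) < |v i| := by
    by_cases h : 1 ≤ (i : ℕ)
    · have hb : (i : ℕ) - 1 < N := by have := i.2; omega
      rw [Finset.sum_eq_single (⟨(i : ℕ) - 1, hb⟩ : Fin N)]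
      · rw [if_pos (by simp only; omega)]
        refine lt_of_le_of_ne (hmax _) fun hc => ?_
        have := himin _ (hc.trans hi)
        simp only at this
        omega
      · intro j _ hj
        exact if_neg fun hc => hj (Fin.ext (by simp only; omega))
      · simp
    · rw [Finset.sum_eq_zero]
      · exact hM
      · intro j _
        exact if_neg (by omega)
  linarith

/-- The hopping matrix has a smallest eigenvalue, and `groundEnergy` is it. -/
theorem groundEnergy_isLeast (a : ℕ → ℝ) (N : ℕ) (hN : 1 ≤ N) :
    IsLeast {μ : ℝ | Module.End.HasEigenvalue (Matrix.toLin' (hoppingMatrix a N)) μ}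
      (groundEnergy a N) := by
  have hH : (hoppingMatrix a N).IsHermitian := by
    ext i j
    simp only [Matrix.conjTranspose_apply, hoppingMatrix, Matrix.of_apply, star_trivial]
    by_cases h : i = j
    · simp [h]
    · have h' : ¬ j = i := fun hc => h hc.symm
      simp only [h, h', if_false]
      split_ifs <;> first | rfl | omega
  have hne : {μ : ℝ | Module.End.HasEigenvalue (Matrix.toLin' (hoppingMatrix a N)) μ}.Nonempty := by
    refine ⟨hH.eigenvalues ⟨0, hN⟩, ?_⟩
    rw [Set.mem_ofPred_eq, Module.End.hasEigenvalue_iff_mem_spectrum, Matrix.spectrum_toLin']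
    exact hH.eigenvalues_mem_spectrum_real _
  have hfin := Module.End.finite_hasEigenvalue (Matrix.toLin' (hoppingMatrix a N))
  exact ⟨hne.csInf_mem hfin, fun μ hμ => csInf_le hfin.bddBelow hμ⟩

/-! A run of couplings close to `1` acts as a clean box. A clean box of length `T` has the parabola
`n (T - n) / 2` as landscape, with maximum `T ^ 2 / 8`, and ground energy about `(π / T) ^ 2`. A run
of `L` couplings within order `T⁻²` of `1` has probability about `T ^ (-2 L)`; since `2 T log T ∼
log N` for `T = lengthScale N`, the longest such run below `N` has length about `T`.

Existence: `ae_eventually_exists_stretch` yields a run of length about `(1 - ε) T`. Comparing the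
landscape with a parabola on it (`le_norm_landscape`) and testing the energy with a sine
(`groundEnergy_le`) gives the lower bound `1/8` and the upper bound `π ^ 2`.

Absence of longer runs: `ae_eventually_disorder_ge` gives every window of length about `(1 + ε) T`
total disorder at least `1 / (ε T)`. In `norm_landscape_le`, a landscape staying above a height `h`
across such a window would have to bend upwards more than its slopes allow: second differences are
at least `-1` and values at most `M`, so slopes are at most `√(2 M + 1)`. Hence the landscape dips
below some `h` of order `ε (T ^ 2 + M)` in every window, and between two dips it exceeds `h` by at
most the maximum of a parabola. Letting `ε → 0` gives the upper bound `1/8`.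

The lower bounds on the energy come from `1 ≤ λ ‖u‖` (`one_le_groundEnergy_mul_norm`). -/

/-! ### Minimum principle, landscape equation and comparison -/

/-- A discrete minimum principle on the integer interval `[p, q]`. -/
theorem hopping_min_principle {b f : ℕ → ℝ} {p q : ℕ} (hb : ∀ n, b n ∈ Set.Icc (0 : ℝ) 1)
    (hp : 0 ≤ f p) (hq : 0 ≤ f q)
    (hf : ∀ n, p < n → n < q → b n * f (n - 1) + b (n + 1) * f (n + 1) ≤ 2 * f n) :
    ∀ n, p ≤ n → n ≤ q → 0 ≤ f n := by
  intro k hpk hkq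
  by_contra! hk
  obtain ⟨m, hm, hmin⟩ := Finset.exists_min_image (Finset.Icc p q) f
    ⟨k, Finset.mem_Icc.2 ⟨hpk, hkq⟩⟩
  -- The leftmost minimiser makes the inequality with its left neighbour strict; without strictness,
  -- couplings equal to `1` would give no contradiction.
  obtain ⟨i, hi, himin⟩ := Finset.exists_min_image
    ((Finset.Icc p q).filter fun i => f i = f m) (fun i => i) ⟨m, by simp [hm]⟩
  simp only [Finset.mem_filter, Finset.mem_Icc] at hi himin hmin hm
  have hneg : f i < 0 := by
    rw [hi.2]; exact (hmin k ⟨hpk, hkq⟩).trans_lt hk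
  have hpi : p < i := lt_of_le_of_ne hi.1.1 (by rintro rfl; linarith)
  have hiq : i < q := lt_of_le_of_ne hi.1.2 (by rintro rfl; linarith)
  have h1 : f i < f (i - 1) := by
    refine lt_of_le_of_ne (hi.2 ▸ hmin _ ⟨by omega, by omega⟩) fun hc => ?_
    have := himin (i - 1) ⟨⟨by omega, by omega⟩, by rw [← hc, hi.2]⟩
    omega
  have h2 : f i ≤ f (i + 1) := hi.2 ▸ hmin _ ⟨by omega, by omega⟩
  have h3 := hf i hpi hiq
  have e1 : f i < b i * f (i - 1) := by
    rcases le_or_gt 0 (f (i - 1)) with h | h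
    · exact hneg.trans_le (mul_nonneg (hb i).1 h)
    · nlinarith [(hb i).2]
  have e2 : f i ≤ b (i + 1) * f (i + 1) := by
    rcases le_or_gt 0 (f (i + 1)) with h | h
    · exact hneg.le.trans (mul_nonneg (hb (i + 1)).1 h)
    · nlinarith [(hb (i + 1)).2]
  linarith

/-- Sites `1, …, N` carry the values of a vector; all other sites carry `0`. -/
def extendZero {N : ℕ} (v : Fin N → ℝ) (n : ℕ) : ℝ :=
  if h : 1 ≤ n ∧ n ≤ N then v ⟨n - 1, by omega⟩ else 0

theorem extendZero_zero {N : ℕ} (v : Fin N → ℝ) : extendZero v 0 = 0 := by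
  simp [extendZero]

theorem extendZero_end {N : ℕ} (v : Fin N → ℝ) : extendZero v (N + 1) = 0 := by
  simp [extendZero]

theorem extendZero_succ {N : ℕ} (v : Fin N → ℝ) (i : Fin N) :
    extendZero v ((i : ℕ) + 1) = v i := by
  have := i.2
  simp [extendZero]

/-- Zero boundary values remove the spurious couplings `b 1` and `b (N + 1)`, so one three-term
formula serves every row. -/
theorem hoppingMatrix_mulVec (b f : ℕ → ℝ) {N : ℕ} (h0 : f 0 = 0) (hN : f (N + 1) = 0)
    (i : Fin N) :
    Matrix.mulVec (hoppingMatrix b N) (fun j => f ((j : ℕ) + 1)) i =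
      2 * f (i + 1) - b (i + 1) * f i - b (i + 2) * f (i + 2) := by
  have hsplit : ∀ j : Fin N, hoppingMatrix b N i j * f ((j : ℕ) + 1) =
      (if (j : ℕ) = i then 2 * f (i + 1) else 0) +
      (if (j : ℕ) = i + 1 then -b (i + 2) * f (i + 2) else 0) +
      (if (i : ℕ) = j + 1 then -b (i + 1) * f i else 0) := by
    intro j
    simp only [hoppingMatrix, Matrix.of_apply]
    by_cases c0 : i = j
    · subst c0; simp
    · have c0' : ¬ (j : ℕ) = i := fun h => c0 (Fin.ext h.symm)
      by_cases c1 : (j : ℕ) = i + 1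
      · have c2 : ¬ (i : ℕ) = j + 1 := by omega
        rw [if_neg c0, if_pos c1, if_neg c0', if_pos c1, if_neg c2, c1]; ring
      · by_cases c2 : (i : ℕ) = j + 1
        · rw [if_neg c0, if_neg c1, if_pos c2, if_neg c0', if_neg c1, if_pos c2, c2]; ring
        · simp [c0, c1, c2, c0']
  have hi := i.2
  simp only [Matrix.mulVec, dotProduct, hsplit, Finset.sum_add_distrib]
  rw [Fin.sum_univ_eq_sum_range (fun j => if j = (i : ℕ) then 2 * f (i + 1) else 0) N,
    Fin.sum_univ_eq_sum_range (fun j => if j = (i : ℕ) + 1 then -b (i + 2) * f (i + 2) else 0) N,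
    Fin.sum_univ_eq_sum_range (fun j => if (i : ℕ) = j + 1 then -b (i + 1) * f i else 0) N]
  have e1 : ∑ j ∈ Finset.range N, (if j = (i : ℕ) then 2 * f (i + 1) else 0) = 2 * f (i + 1) := by
    rw [Finset.sum_ite_eq', if_pos (Finset.mem_range.2 hi)]
  have e2 : ∑ j ∈ Finset.range N, (if j = (i : ℕ) + 1 then -b (i + 2) * f (i + 2) else 0) =
      -b (i + 2) * f (i + 2) := by
    rw [Finset.sum_ite_eq']
    split_ifs with h
    · rfl
    · rw [Finset.mem_range] at h
      have : (i : ℕ) + 2 = N + 1 := by omega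
      rw [this, hN, mul_zero]
  have e3 : ∑ j ∈ Finset.range N, (if (i : ℕ) = j + 1 then -b (i + 1) * f i else 0) =
      -b (i + 1) * f i := by
    rcases Nat.eq_zero_or_pos (i : ℕ) with h | h
    · rw [h, h0]; simp
    · rw [Finset.sum_eq_single ((i : ℕ) - 1)]
      · rw [if_pos (by omega)]
      · intro j _ hj; exact if_neg (by omega)
      · intro hc; exact absurd (Finset.mem_range.2 (by omega)) hc
  rw [e1, e2, e3]; ring

theorem hoppingMatrix_mulVec_extendZero (b : ℕ → ℝ) {N : ℕ} (v : Fin N → ℝ) (i : Fin N) :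
    Matrix.mulVec (hoppingMatrix b N) v i =
      2 * extendZero v (i + 1) - b (i + 1) * extendZero v i - b (i + 2) * extendZero v (i + 2) := by
  rw [← hoppingMatrix_mulVec b _ (extendZero_zero v) (extendZero_end v)]
  congr 1
  ext j
  rw [extendZero_succ]

/-- The defining equation of the landscape function. -/
theorem landscape_equation {b : ℕ → ℝ} {N : ℕ} (hb : ∀ n, b n ∈ Set.Icc (0 : ℝ) 1) {n : ℕ}
    (h1 : 0 < n) (hn : n < N + 1) :
    b n * extendZero (landscape b N) (n - 1) + b (n + 1) * extendZero (landscape b N) (n + 1) + 1 =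
      2 * extendZero (landscape b N) n := by
  have hdet := hoppingMatrix_isUnit_det b N fun j _ => hb j
  have hmul : Matrix.mulVec (hoppingMatrix b N) (landscape b N) = fun _ => 1 := by
    rw [landscape, Matrix.mulVec_mulVec, Matrix.mul_nonsing_inv _ hdet, Matrix.one_mulVec]
  have := congrFun hmul ⟨n - 1, by omega⟩
  rw [hoppingMatrix_mulVec_extendZero] at this
  simp only [show n - 1 + 1 = n by omega, show n - 1 + 2 = n + 1 by omega] at this
  linarith

/-- Comparison of a subsolution with a multiple of the landscape function. -/
theorem le_landscape_of_subsolution {b f : ℕ → ℝ} {N p q : ℕ}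
    (hb : ∀ n, b n ∈ Set.Icc (0 : ℝ) 1) {c : ℝ} (hq : q ≤ N + 1)
    (hfp : f p ≤ c * extendZero (landscape b N) p) (hfq : f q ≤ c * extendZero (landscape b N) q)
    (hf : ∀ n, p < n → n < q → 2 * f n ≤ b n * f (n - 1) + b (n + 1) * f (n + 1) + c) :
    ∀ n, p ≤ n → n ≤ q → f n ≤ c * extendZero (landscape b N) n := by
  intro n hpn hnq
  have := hopping_min_principle (b := b) (p := p) (q := q)
    (f := fun n => c * extendZero (landscape b N) n - f n) hb
    (by simpa using hfp) (by simpa using hfq)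
    (fun n h1 h2 => by
      have e1 := hf n h1 h2
      have e2 := landscape_equation (N := N) hb (n := n) (by omega) (by omega)
      have e3 := congrArg (fun x => c * x) e2
      nlinarith) n hpn hnq
  linarith

theorem extendZero_landscape_nonneg {b : ℕ → ℝ} (N : ℕ) (hb : ∀ n, b n ∈ Set.Icc (0 : ℝ) 1)
    (n : ℕ) : 0 ≤ extendZero (landscape b N) n := by
  by_cases h : n ≤ N + 1
  · have := le_landscape_of_subsolution (b := b) (f := fun _ => 0) (N := N) (p := 0) (q := N + 1)
      hb (c := 1) le_rfl (by rw [extendZero_zero]; simp) (by rw [extendZero_end]; simp)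
      (fun n _ _ => by simp) n (Nat.zero_le _) h
    simpa using this
  · rw [extendZero, dif_neg (by omega)]

theorem extendZero_abs_le {N : ℕ} (v : Fin N → ℝ) (n : ℕ) : |extendZero v n| ≤ ‖v‖ := by
  unfold extendZero
  split_ifs with h
  · exact norm_le_pi_norm v _
  · simp

theorem extendZero_le_norm {N : ℕ} (v : Fin N → ℝ) (n : ℕ) : extendZero v n ≤ ‖v‖ :=
  (le_abs_self _).trans (extendZero_abs_le v n)

theorem exists_abs_extendZero_eq_norm {N : ℕ} (hN : 1 ≤ N) (v : Fin N → ℝ) :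
    ∃ n, 0 < n ∧ n < N + 1 ∧ |extendZero v n| = ‖v‖ := by
  obtain ⟨i, -, hi⟩ := Finset.exists_max_image Finset.univ (fun i => ‖v i‖)
    ⟨⟨0, hN⟩, Finset.mem_univ _⟩
  refine ⟨i + 1, by omega, by have := i.2; omega, ?_⟩
  rw [extendZero_succ, ← Real.norm_eq_abs]
  exact le_antisymm (norm_le_pi_norm v i)
    ((pi_norm_le_iff_of_nonneg (norm_nonneg _)).2 fun j => hi j (Finset.mem_univ j))

/-- The landscape bound `1 ≤ λ ‖u‖` for the ground state energy. -/
theorem one_le_groundEnergy_mul_norm {b : ℕ → ℝ} {N : ℕ} (hN : 1 ≤ N)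
    (hb : ∀ n, b n ∈ Set.Icc (0 : ℝ) 1) :
    0 < groundEnergy b N ∧ 1 ≤ groundEnergy b N * ‖landscape b N‖ := by
  obtain ⟨v, hv⟩ := (groundEnergy_isLeast b N hN).1.exists_hasEigenvector
  set l := groundEnergy b N
  have hv0 : 0 < ‖v‖ := norm_pos_iff.2 hv.2
  have heq : ∀ n, 0 < n → n < N + 1 → 2 * extendZero v n - b n * extendZero v (n - 1) -
      b (n + 1) * extendZero v (n + 1) = l * extendZero v n := by
    intro n h1 h2
    have h3 : Matrix.mulVec (hoppingMatrix b N) v = l • v := by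
      simpa using hv.apply_eq_smul
    have h4 := congrFun h3 ⟨n - 1, by omega⟩
    rw [hoppingMatrix_mulVec_extendZero, Pi.smul_apply, ← extendZero_succ v, smul_eq_mul] at h4
    simp only [show n - 1 + 1 = n by omega, show n - 1 + 2 = n + 1 by omega] at h4
    exact h4
  have hbabs : ∀ n x, |b n * x| ≤ |x| := fun n x => by
    rw [abs_mul, abs_of_nonneg (hb n).1]
    exact mul_le_of_le_one_left (abs_nonneg _) (hb n).2
  -- The modulus of the eigenvector is a subsolution with source `|l| * ‖v‖`; evaluating at a site
  -- where `|v|` is maximal then cancels `‖v‖`.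
  have hsub : ∀ n, 0 ≤ n → n ≤ N + 1 →
      |extendZero v n| ≤ (|l| * ‖v‖) * extendZero (landscape b N) n := by
    refine le_landscape_of_subsolution (f := fun n => |extendZero v n|) hb le_rfl ?_ ?_ ?_
    · simp [extendZero_zero]
    · simp [extendZero_end]
    · intro n h1 h2
      have h3 := heq n h1 h2
      have h4 : 2 * extendZero v n = b n * extendZero v (n - 1) +
        b (n + 1) * extendZero v (n + 1) + l * extendZero v n := by linarith
      calc 2 * |extendZero v n| = |2 * extendZero v n| := by rw [abs_mul]; norm_num
        _ ≤ |b n * extendZero v (n - 1)| + |b (n + 1) * extendZero v (n + 1)| +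
            |l * extendZero v n| := by rw [h4]; exact abs_add_three _ _ _
        _ ≤ _ := by
          rw [abs_mul, abs_mul, abs_mul, abs_of_nonneg (hb n).1, abs_of_nonneg (hb (n + 1)).1]
          have := mul_le_mul_of_nonneg_left (extendZero_abs_le v n) (abs_nonneg l)
          linarith
  obtain ⟨n, hn0, hnN, hn⟩ := exists_abs_extendZero_eq_norm hN v
  have h1 : 1 ≤ |l| * ‖landscape b N‖ := by
    have h2 := hsub n hn0.le hnN.le
    rw [hn] at h2
    have h3 : ‖v‖ ≤ |l| * ‖v‖ * ‖landscape b N‖ :=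
      h2.trans (mul_le_mul_of_nonneg_left (extendZero_le_norm _ _) (by positivity))
    by_contra! hc
    nlinarith
  -- At the same maximal site, a negative `l` would make `(2 - l) ‖v‖` exceed what two neighbours
  -- can supply.
  have hl : 0 ≤ l := by
    by_contra! hc
    have h3 := heq n hn0 hnN
    have h4 : (2 - l) * extendZero v n = b n * extendZero v (n - 1) +
      b (n + 1) * extendZero v (n + 1) := by linarith
    have h5 : (2 - l) * ‖v‖ ≤ 2 * ‖v‖ := by
      calc (2 - l) * ‖v‖ = |(2 - l) * extendZero v n| := by
            rw [abs_mul, hn, abs_of_pos (by linarith)]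
        _ ≤ |b n * extendZero v (n - 1)| + |b (n + 1) * extendZero v (n + 1)| := by
            rw [h4]; exact abs_add_le _ _
        _ ≤ ‖v‖ + ‖v‖ := add_le_add ((hbabs _ _).trans (extendZero_abs_le _ _))
            ((hbabs _ _).trans (extendZero_abs_le _ _))
        _ = _ := by ring
    nlinarith
  rw [abs_of_nonneg hl] at h1
  refine ⟨lt_of_le_of_ne hl fun hc => ?_, h1⟩
  rw [← hc] at h1
  norm_num at h1

/-! ### Consequences of one nearly clean stretch -/

/-- A stretch of strong couplings makes the landscape function large. -/
theorem le_norm_landscape {b : ℕ → ℝ} {N p L : ℕ} {δ : ℝ} (hb : ∀ n, b n ∈ Set.Icc (0 : ℝ) 1)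
    (hδ : 0 ≤ δ) (hpL : p + L ≤ N) (hstretch : ∀ n, p < n → n ≤ p + L → 1 - δ ≤ b n) :
    ((L : ℝ) ^ 2 - 1) / 8 ≤ (1 + δ * L ^ 2 / 4) * ‖landscape b N‖ := by
  set c : ℝ := 1 + δ * L ^ 2 / 4
  have hc : 1 ≤ c := by
    have : 0 ≤ δ * L ^ 2 / 4 := by positivity
    simp only [c]; linarith
  have hU := extendZero_landscape_nonneg N hb
  have hw : ∀ n : ℕ, ((n : ℝ) - p) * (p + L - n) / 2 ≤ L ^ 2 / 8 := fun n => by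
    nlinarith [sq_nonneg ((n : ℝ) - p - (p + L - n))]
  -- The parabola has second difference `-1` and is at most `L ^ 2 / 8`, so each of the two
  -- couplings at a site costs at most `δ L ^ 2 / 8`; this explains `c`.
  have key := le_landscape_of_subsolution (b := b) (N := N) (p := p) (q := p + L) (c := c)
    (f := fun n : ℕ => ((n : ℝ) - p) * (p + L - n) / 2) hb (by omega)
    (by simpa using mul_nonneg (by linarith) (hU p))
    (by push_cast; simpa using mul_nonneg (by linarith) (hU _)) (by
      intro n h1 h2
      have b1 := hstretch n h1 h2.le
      have b2 := hstretch (n + 1) (by omega) (by omega)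
      have w1 := hw (n - 1)
      have w2 := hw (n + 1)
      have s1 := (hb n).2
      have s2 := (hb (n + 1)).2
      rw [Nat.cast_sub (by omega : 1 ≤ n)] at *
      push_cast at *
      have m1 := mul_nonneg (sub_nonneg.2 s1) (sub_nonneg.2 w1)
      have m2 := mul_nonneg (sub_nonneg.2 s2) (sub_nonneg.2 w2)
      have m3 : (1 - b n) * (L ^ 2 / 8) ≤ δ * (L ^ 2 / 8) :=
        mul_le_mul_of_nonneg_right (by linarith) (by positivity)
      have m4 : (1 - b (n + 1)) * (L ^ 2 / 8) ≤ δ * (L ^ 2 / 8) :=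
        mul_le_mul_of_nonneg_right (by linarith) (by positivity)
      simp only [c]
      linarith) (p + L / 2) (by omega) (by omega)
  -- The `-1` is the rounding loss at the midpoint, attained for odd `L`.
  have h1 : ((L : ℝ) ^ 2 - 1) / 8 ≤ ((p + L / 2 : ℕ) - (p : ℝ)) * (p + L - (p + L / 2 : ℕ)) / 2 := by
    obtain ⟨k, hk | hk⟩ := Nat.even_or_odd' L
    · have : L / 2 = k := by omega
      rw [this, hk]; push_cast; nlinarith
    · have : L / 2 = k := by omega
      rw [this, hk]; push_cast; nlinarith
  exact h1.trans (key.trans (mul_le_mul_of_nonneg_left (extendZero_le_norm _ _) (by linarith)))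

theorem hoppingMatrix_isHermitian (b : ℕ → ℝ) (N : ℕ) : (hoppingMatrix b N).IsHermitian := by
  ext i j
  simp only [Matrix.conjTranspose_apply, hoppingMatrix, Matrix.of_apply, star_trivial]
  by_cases h : i = j
  · simp [h]
  · have h' : ¬ j = i := fun hc => h hc.symm
    simp only [h, h', if_false]
    split_ifs <;> first | rfl | omega

-- Variational principle: an eigenvalue of `H - l` shifted by `l` is an eigenvalue of `H`, hence at
-- least `l`, so `H - l` is positive semidefinite.
open Matrix in
theorem groundEnergy_mul_dotProduct_le (b : ℕ → ℝ) {N : ℕ} (hN : 1 ≤ N) (v : Fin N → ℝ) :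
    groundEnergy b N * (v ⬝ᵥ v) ≤ v ⬝ᵥ (hoppingMatrix b N *ᵥ v) := by
  set l := groundEnergy b N
  have hA : (hoppingMatrix b N - l • (1 : Matrix (Fin N) (Fin N) ℝ)).IsHermitian :=
    (hoppingMatrix_isHermitian b N).sub (by
      ext i j; simp [Matrix.one_apply, eq_comm])
  have hps : (hoppingMatrix b N - l • (1 : Matrix (Fin N) (Fin N) ℝ)).PosSemidef := by
    rw [hA.posSemidef_iff_eigenvalues_nonneg]
    intro i
    have h1 := hA.mulVec_eigenvectorBasis i
    have hne : (hA.eigenvectorBasis i : Fin N → ℝ) ≠ 0 := by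
      intro hc
      apply hA.eigenvectorBasis.toBasis.ne_zero i
      ext j
      simpa using congrFun hc j
    rw [Matrix.sub_mulVec, Matrix.smul_mulVec, Matrix.one_mulVec] at h1
    have h2 : Module.End.HasEigenvalue (Matrix.toLin' (hoppingMatrix b N))
        (hA.eigenvalues i + l) := by
      refine Module.End.hasEigenvalue_of_hasEigenvector (x := (hA.eigenvectorBasis i : Fin N → ℝ))
        ⟨Module.End.mem_eigenspace_iff.2 ?_, hne⟩
      rw [Matrix.toLin'_apply, add_smul, ← h1, sub_add_cancel]
    have := (groundEnergy_isLeast b N hN).2 h2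
    simp only [Pi.zero_apply]
    linarith
  have := hps.dotProduct_mulVec_nonneg v
  rw [Matrix.sub_mulVec, Matrix.smul_mulVec, Matrix.one_mulVec, dotProduct_sub, dotProduct_smul,
    star_trivial, smul_eq_mul] at this
  linarith

/-- A nonnegative subsolution of the eigenvalue equation bounds the ground state energy. -/
theorem groundEnergy_le_of_subsolution {b f : ℕ → ℝ} {N : ℕ} {κ : ℝ} (h0 : f 0 = 0)
    (hN : f (N + 1) = 0) (hf : ∀ n, 0 ≤ f n) {k : ℕ} (hk0 : 0 < k) (hkN : k < N + 1)
    (hk : 0 < f k) (hsub : ∀ n, 0 < n → n < N + 1 →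
      2 * f n - b n * f (n - 1) - b (n + 1) * f (n + 1) ≤ κ * f n) :
    groundEnergy b N ≤ κ := by
  have h1 := groundEnergy_mul_dotProduct_le b (by omega : 1 ≤ N) (fun j => f ((j : ℕ) + 1))
  have h2 : dotProduct (fun j : Fin N => f ((j : ℕ) + 1))
      (Matrix.mulVec (hoppingMatrix b N) (fun j => f ((j : ℕ) + 1))) ≤
      κ * dotProduct (fun j : Fin N => f ((j : ℕ) + 1)) (fun j => f ((j : ℕ) + 1)) := by
    simp only [dotProduct, Finset.mul_sum]
    refine Finset.sum_le_sum fun i _ => ?_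
    rw [hoppingMatrix_mulVec b f h0 hN]
    have := hsub (i + 1) (by omega) (by have := i.2; omega)
    simp only [add_tsub_cancel_right] at this
    have := mul_le_mul_of_nonneg_left this (hf (i + 1))
    linarith
  have h3 : 0 < dotProduct (fun j : Fin N => f ((j : ℕ) + 1)) (fun j => f ((j : ℕ) + 1)) := by
    simp only [dotProduct]
    refine Finset.sum_pos' (fun i _ => mul_self_nonneg _) ⟨⟨k - 1, by omega⟩, Finset.mem_univ _, ?_⟩
    simp only [show k - 1 + 1 = k by omega]
    positivity
  exact le_of_mul_le_mul_right (h1.trans h2) h3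

/-- A stretch of strong couplings makes the ground state energy small. -/
theorem groundEnergy_le {b : ℕ → ℝ} {N p L : ℕ} {δ : ℝ} (hb : ∀ n, b n ∈ Set.Icc (0 : ℝ) 1)
    (hδ : 0 ≤ δ) (hL : 2 ≤ L) (hpL : p + L ≤ N)
    (hstretch : ∀ n, p < n → n ≤ p + L → 1 - δ ≤ b n) :
    groundEnergy b N ≤ (Real.pi / L) ^ 2 + 2 * δ := by
  have hL0 : (0 : ℝ) < L := by positivity
  set θ : ℝ := Real.pi / L
  have hθ : 0 < θ := by positivity
  have hθL : θ * L = Real.pi := by simp only [θ]; field_simp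
  -- Dirichlet ground state of the stretch, extended by zero. Off the interior its value is `0` and
  -- its neighbours are nonnegative, so the subsolution inequality is free there.
  set f : ℕ → ℝ := fun n => if p ≤ n ∧ n ≤ p + L then Real.sin (θ * (n - p)) else 0
  have hf : ∀ n, 0 ≤ f n := by
    intro n
    simp only [f]
    split_ifs with h
    · have h1 : (p : ℝ) ≤ n := by exact_mod_cast h.1
      have h2 : (n : ℝ) ≤ p + L := by exact_mod_cast h.2
      refine Real.sin_nonneg_of_nonneg_of_le_pi (mul_nonneg hθ.le (by linarith)) ?_
      rw [← hθL]
      exact mul_le_mul_of_nonneg_left (by linarith) hθ.le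
    · exact le_rfl
  have hfp : f p = 0 := by simp [f]
  have hfq : f (p + L) = 0 := by simp [f, hθL]
  refine groundEnergy_le_of_subsolution (f := f) (k := p + 1) ?_ ?_ hf (by omega) (by omega) ?_ ?_
  · rcases Nat.eq_zero_or_pos p with h | h
    · rw [← h]; exact hfp
    · exact if_neg (by omega)
  · exact if_neg (by omega)
  · simp only [f]
    rw [if_pos (by omega)]
    have : θ * ((p + 1 : ℕ) - (p : ℝ)) = θ := by push_cast; ring
    rw [this]
    refine Real.sin_pos_of_pos_of_lt_pi hθ ?_
    rw [← hθL]
    have : (2 : ℝ) ≤ L := by exact_mod_cast hL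
    nlinarith
  · intro n h1 h2
    by_cases hin : p < n ∧ n < p + L
    · have e0 : f n = Real.sin (θ * (n - p)) := if_pos (by omega)
      have e1 : f (n - 1) = Real.sin (θ * (n - p) - θ) := by
        simp only [f]
        rw [if_pos (by omega), Nat.cast_sub (by omega)]
        congr 1; push_cast; ring
      have e2 : f (n + 1) = Real.sin (θ * (n - p) + θ) := by
        simp only [f]
        rw [if_pos (by omega)]
        congr 1; push_cast; ring
      have e3 : f (n - 1) + f (n + 1) = 2 * Real.cos θ * f n := by
        rw [e0, e1, e2, Real.sin_sub, Real.sin_add]; ring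
      have c1 := Real.one_sub_sq_div_two_le_cos (x := θ)
      have c2 := Real.cos_le_one θ
      have g1 := mul_nonneg (by linarith [hstretch n hin.1 hin.2.le] : 0 ≤ b n - (1 - δ))
        (hf (n - 1))
      have g2 := mul_nonneg (by linarith [hstretch (n + 1) (by omega) (by omega)] :
        0 ≤ b (n + 1) - (1 - δ)) (hf (n + 1))
      have g3 := mul_nonneg (by linarith : 0 ≤ Real.cos θ - (1 - θ ^ 2 / 2)) (hf n)
      have g4 := mul_nonneg (mul_nonneg hδ (by linarith : 0 ≤ 1 - Real.cos θ)) (hf n)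
      have e4 := congrArg (fun x => (1 - δ) * x) e3
      nlinarith
    · have e0 : f n = 0 := by
        by_cases c : n = p
        · rw [c, hfp]
        · by_cases c' : n = p + L
          · rw [c', hfq]
          · exact if_neg (by omega)
      have g1 := mul_nonneg (hb n).1 (hf (n - 1))
      have g2 := mul_nonneg (hb (n + 1)).1 (hf (n + 1))
      rw [e0]; linarith

/-! ### Upper bound for the landscape from disorder in every window -/

/-- Growth of a function with second difference at least `-1`. -/
theorem add_mul_slope_le {f : ℕ → ℝ} {n K : ℕ}
    (hf : ∀ m, n < m → m < K → -1 ≤ f (m + 1) - 2 * f m + f (m - 1)) :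
    ∀ t : ℕ, n + t ≤ K → f n + t * (f (n + 1) - f n) - t * (t - 1) / 2 ≤ f (n + t) := by
  have hslope : ∀ t : ℕ, n + t + 1 ≤ K → f (n + 1) - f n - t ≤ f (n + t + 1) - f (n + t) := by
    intro t
    induction t with
    | zero => intro _; simp
    | succ t ih =>
      intro ht
      have h1 := ih (by omega)
      have h2 := hf (n + t + 1) (by omega) (by omega)
      simp only [add_tsub_cancel_right] at h2
      rw [show n + (t + 1) = n + t + 1 by ring]
      push_cast
      linarith
  intro t
  induction t with
  | zero => intro _; simp
  | succ t ih =>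
    intro ht
    have h1 := ih (by omega)
    have h2 := hslope t (by omega)
    rw [show n + (t + 1) = n + t + 1 by ring]
    push_cast
    linarith

/-- A slope `D` falls by at most `1` per step, so `f` climbs to at least `⌊D⌋ (D + 1) / 2`, and
stays positive too long to meet the zero at `K` on the way. As `⌊D⌋ > D - 1`, this forces `D ^ 2 < 2
M + 1`. -/
theorem slope_le {f : ℕ → ℝ} {K : ℕ} {M : ℝ} (hM : 0 ≤ M) (hK : f K = 0)
    (h0 : ∀ n, 0 ≤ f n) (hfM : ∀ n, f n ≤ M)
    (hf : ∀ m, 0 < m → m < K → -1 ≤ f (m + 1) - 2 * f m + f (m - 1)) {n : ℕ} (hn : n < K) :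
    f (n + 1) - f n ≤ √(2 * M + 1) := by
  set D := f (n + 1) - f n
  rcases lt_or_ge D 1 with hD | hD
  · exact hD.le.trans (Real.one_le_sqrt.2 (by linarith))
  have key := add_mul_slope_le (f := f) (n := n) (K := K) fun m h1 h2 => hf m (by omega) h2
  have hlow : ∀ t : ℕ, n + t ≤ K → (t : ℝ) ≤ D → t * (D + 1) / 2 ≤ f (n + t) := by
    intro t ht htD
    have h1 := key t ht
    have h2 := h0 n
    have h3 : (0 : ℝ) ≤ t := t.cast_nonneg
    nlinarith
  have hfl := Nat.floor_le (by linarith : 0 ≤ D)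
  have hnt : n + ⌊D⌋₊ ≤ K := by
    by_contra! hc
    have h1 : ((K - n : ℕ) : ℝ) ≤ D := (Nat.cast_le.2 (by omega : K - n ≤ ⌊D⌋₊)).trans hfl
    have h2 := hlow (K - n) (by omega) h1
    rw [show n + (K - n) = K by omega, hK] at h2
    have h3 : (1 : ℝ) ≤ (K - n : ℕ) := by exact_mod_cast (by omega : 1 ≤ K - n)
    nlinarith
  have h1 := hlow _ hnt hfl
  have h2 := hfM (n + ⌊D⌋₊)
  have h3 := Nat.lt_floor_add_one D
  exact Real.le_sqrt_of_sq_le (by nlinarith)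

theorem neg_slope_le {f : ℕ → ℝ} {K : ℕ} {M : ℝ} (hM : 0 ≤ M) (hK : f 0 = 0)
    (h0 : ∀ n, 0 ≤ f n) (hfM : ∀ n, f n ≤ M)
    (hf : ∀ m, 0 < m → m < K → -1 ≤ f (m + 1) - 2 * f m + f (m - 1)) {n : ℕ} (hn : n < K) :
    f n - f (n + 1) ≤ √(2 * M + 1) := by
  have := slope_le (f := fun n => f (K - n)) (K := K) hM (by simpa using hK)
    (fun n => h0 _) (fun n => hfM _) (fun m h1 h2 => by
      have := hf (K - m) (by omega) (by omega)
      rw [show K - m + 1 = K - (m - 1) by omega, show K - m - 1 = K - (m + 1) by omega] at this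
      linarith) (n := K - (n + 1)) (by omega)
  simpa [show K - (K - (n + 1) + 1) = n by omega, show K - (K - (n + 1)) = n + 1 by omega] using this

/-- If every stretch of `L` couplings carries enough disorder, the landscape function is not
larger than that of a clean box of length `L + 1`. -/
theorem norm_landscape_le {b : ℕ → ℝ} {N L : ℕ} {μ h : ℝ} (hN : 1 ≤ N)
    (hb : ∀ n, b n ∈ Set.Icc (0 : ℝ) 1) (hh : 0 < h)
    (hwin : ∀ p, 1 ≤ p → p + L ≤ N → μ ≤ ∑ j ∈ Finset.range L, (1 - b (p + j + 1)))
    (hμ : L + 1 + 2 * √(2 * ‖landscape b N‖ + 1) < 2 * h * μ) :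
    ‖landscape b N‖ ≤ h + ((L : ℝ) + 1) ^ 2 / 8 := by
  set U := extendZero (landscape b N) with hU
  set M := ‖landscape b N‖ with hM
  have hM0 : 0 ≤ M := norm_nonneg _
  have hU0 : ∀ n, 0 ≤ U n := extendZero_landscape_nonneg N hb
  have hUM : ∀ n, U n ≤ M := extendZero_le_norm _
  have hz : U 0 = 0 := extendZero_zero _
  have he : U (N + 1) = 0 := extendZero_end _
  have heq : ∀ n, 0 < n → n < N + 1 → U (n + 1) - 2 * U n + U (n - 1) =
      (1 - b n) * U (n - 1) + (1 - b (n + 1)) * U (n + 1) - 1 := fun n h1 h2 => by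
    have := landscape_equation (N := N) hb h1 h2
    linarith
  have hcv : ∀ n, 0 < n → n < N + 1 → -1 ≤ U (n + 1) - 2 * U n + U (n - 1) := fun n h1 h2 => by
    rw [heq n h1 h2]
    have := mul_nonneg (sub_nonneg.2 (hb n).2) (hU0 (n - 1))
    have := mul_nonneg (sub_nonneg.2 (hb (n + 1)).2) (hU0 (n + 1))
    linarith
  have hlowpt : ∀ p, 1 ≤ p → p + L ≤ N → ∃ n, p ≤ n ∧ n ≤ p + L ∧ U n < h := by
    intro p hp hpN
    by_contra! hc
    -- Telescoping the second differences: each coupling inside the window enters through the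
    -- equations at both its ends, hence the doubled sum. The subtracted term with `b (p + l + 1)`
    -- is the half of the last coupling whose partner is not yet summed.
    have hsum : ∀ l ≤ L, h * ∑ j ∈ Finset.range l, (1 - b (p + j + 1)) +
        h * ∑ j ∈ Finset.range l, (1 - b (p + j + 1)) - (l + 1) ≤
        (U (p + l + 1) - U (p + l)) - (1 - b (p + l + 1)) * U (p + l + 1) - (U p - U (p - 1)) := by
      intro l
      induction l with
      | zero =>
        intro _
        have h1 := heq p hp (by omega)
        have h2 := mul_nonneg (sub_nonneg.2 (hb p).2) (hU0 (p - 1))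
        simp only [Finset.range_zero, Finset.sum_empty, add_zero]
        push_cast
        linarith
      | succ l ih =>
        intro hl
        have h1 := ih (by omega)
        have h2 := heq (p + l + 1) (by omega) (by omega)
        have h3 := mul_le_mul_of_nonneg_left (hc (p + l) (by omega) (by omega))
          (sub_nonneg.2 (hb (p + l + 1)).2)
        have h4 := mul_le_mul_of_nonneg_left (hc (p + l + 1) (by omega) (by omega))
          (sub_nonneg.2 (hb (p + l + 1)).2)
        rw [Finset.sum_range_succ, show p + (l + 1) = p + l + 1 by ring]
        simp only [add_tsub_cancel_right] at h2
        push_cast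
        linarith
    have h1 := hsum L le_rfl
    have h2 := mul_le_mul_of_nonneg_left (hwin p hp hpN) hh.le
    have h3 := mul_nonneg (sub_nonneg.2 (hb (p + L + 1)).2) (hU0 (p + L + 1))
    have h4 := slope_le hM0 he hU0 hUM hcv (n := p + L) (by omega)
    have h5 := neg_slope_le hM0 hz hU0 hUM hcv (n := p - 1) (by omega)
    rw [show p - 1 + 1 = p by omega] at h5
    linarith
  obtain ⟨m, hm0, hmN, hm⟩ := exists_abs_extendZero_eq_norm hN (landscape b N)
  rw [abs_of_nonneg (hU0 m)] at hm
  change U m = M at hm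
  rcases lt_or_ge M h with hMh | hMh
  · have : (0 : ℝ) ≤ (L + 1) ^ 2 / 8 := by positivity
    linarith
  -- `p` and `q` are the nearest sites below height `h` on either side of the maximum `m`; the
  -- boundary zeros guarantee that they exist.
  obtain ⟨p, hp, hpmax⟩ := Finset.exists_max_image
    ((Finset.range (m + 1)).filter fun i => U i < h) (fun i => i) ⟨0, by simp [hz, hh]⟩
  obtain ⟨q, hq, hqmin⟩ := Finset.exists_min_image
    ((Finset.Icc m (N + 1)).filter fun i => U i < h) (fun i => i)
    ⟨N + 1, by simp [he, hh, hmN.le]⟩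
  simp only [Finset.mem_filter, Finset.mem_range, Finset.mem_Icc] at hp hq hpmax hqmin
  have hpm : p < m := lt_of_le_of_ne (by omega) (by rintro rfl; linarith)
  have hmq : m < q := lt_of_le_of_ne (by omega) (by rintro rfl; linarith)
  have hgap : q ≤ p + L + 1 := by
    by_contra! hc
    obtain ⟨n, hn1, hn2, hn3⟩ := hlowpt (p + 1) (by omega) (by omega)
    rcases le_or_gt n m with hnm | hnm
    · have := hpmax n ⟨by omega, hn3⟩
      omega
    · have := hqmin n ⟨⟨by omega, by omega⟩, hn3⟩
      omega
  obtain ⟨t, rfl⟩ := Nat.exists_eq_add_of_lt hmq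
  obtain ⟨s, rfl⟩ := Nat.exists_eq_add_of_lt hpm
  have r := add_mul_slope_le (f := U) (n := p + s + 1) (K := N + 1)
    (fun k h1 h2 => hcv k (by omega) h2) (t + 1) (by omega)
  have l := add_mul_slope_le (f := fun k => U (p + s + 1 - k)) (n := 0) (K := p + s + 1)
    (fun k h1 h2 => by
      have := hcv (p + s + 1 - k) (by omega) (by omega)
      rw [show p + s + 1 - k + 1 = p + s + 1 - (k - 1) by omega,
        show p + s + 1 - k - 1 = p + s + 1 - (k + 1) by omega] at this
      linarith) (s + 1) (by omega)
  have hc := hcv (p + s + 1) (by omega) (by omega)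
  simp only [zero_add, Nat.sub_zero, add_tsub_cancel_right,
    show p + s + 1 - (s + 1) = p by omega] at l hc
  have hq2 := hq.2
  rw [show p + s + 1 + t + 1 = p + s + 1 + (t + 1) by ring] at hq2
  rw [hm] at r l hc
  push_cast at r l
  set x := U (p + s + 1 + 1)
  set y := U (p + s)
  have ht : (0 : ℝ) ≤ t := t.cast_nonneg
  have hs : (0 : ℝ) ≤ s := s.cast_nonneg
  -- These weights eliminate the neighbouring values `x` and `y`, leaving `M ≤ h + (m - p) (q - m) /
  -- 2`.
  have h1 := mul_le_mul_of_nonneg_left (r.trans hq2.le) (by linarith : (0 : ℝ) ≤ s + 1)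
  have h2 := mul_le_mul_of_nonneg_left (l.trans hp.2.le) (by linarith : (0 : ℝ) ≤ t + 1)
  have h3 := mul_le_mul_of_nonneg_left hc (by positivity : (0 : ℝ) ≤ (s + 1) * (t + 1))
  have h4 : M ≤ h + (s + 1) * (t + 1) / 2 := by
    have h5 : ((s : ℝ) + t + 2) * M ≤ (s + t + 2) * (h + (s + 1) * (t + 1) / 2) := by linarith
    exact le_of_mul_le_mul_left h5 (by linarith)
  have h6 : (s : ℝ) + t + 2 ≤ L + 1 := by exact_mod_cast (by omega : s + t + 2 ≤ L + 1)
  nlinarith [sq_nonneg ((s : ℝ) - t)]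

/-! ### Probability estimates for independent uniform couplings -/

section Probability

variable {Ω : Type*} [MeasurableSpace Ω] {P : Measure Ω}

/-- The blocks `[k L, (k + 1) L)` are disjoint, hence independent, and each is entirely good with
probability at least `p ^ L`. -/
theorem measure_no_good_block_le [IsProbabilityMeasure P] {Y : ℕ → Ω → ℝ} (hind : iIndepFun Y P) (hY : ∀ i, Measurable (Y i))
    {B : Set ℝ} (hB : MeasurableSet B) {p : ℝ} (hp : ∀ i, p ≤ P.real (Y i ⁻¹' B)) (hp0 : 0 ≤ p)
    (L m : ℕ) :
    P.real {ω | ∀ k < m, ∃ i < L, Y (k * L + i) ω ∉ B} ≤ (1 - p ^ L) ^ m := by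
  have hp1 : p ≤ 1 := (hp 0).trans measureReal_le_one
  have hblock : ∀ k, P.real {ω | ∃ i < L, Y (k * L + i) ω ∉ B} ≤ 1 - p ^ L := by
    intro k
    have hset : {ω | ∃ i < L, Y (k * L + i) ω ∉ B} =
        (⋂ i ∈ Finset.image (fun i => k * L + i) (Finset.range L), Y i ⁻¹' B)ᶜ := by
      ext ω
      simp
    rw [hset, probReal_compl_eq_one_sub]
    · have h1 : P (⋂ i ∈ Finset.image (fun i => k * L + i) (Finset.range L), Y i ⁻¹' B) =
          ∏ i ∈ Finset.image (fun i => k * L + i) (Finset.range L), P (Y i ⁻¹' B) :=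
        hind.meas_biInter fun i _ => ⟨B, hB, rfl⟩
      rw [measureReal_def, h1, ENNReal.toReal_prod]
      have h2 : ∏ _i ∈ Finset.image (fun i => k * L + i) (Finset.range L), p ≤
          ∏ i ∈ Finset.image (fun i => k * L + i) (Finset.range L), (P (Y i ⁻¹' B)).toReal :=
        Finset.prod_le_prod (fun _ _ => hp0) fun i _ => hp i
      rw [Finset.prod_const, Finset.card_image_of_injective _ (add_right_injective _),
        Finset.card_range] at h2
      linarith
    · exact Finset.measurableSet_biInter _ fun i _ => hY i hB
  have hnn : 0 ≤ 1 - p ^ L := by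
    have := pow_le_one₀ (n := L) hp0 hp1
    linarith
  have hmem : ∀ (S : Set ℕ) (i : ℕ), i ∈ S →
      MeasurableSet[⨆ i ∈ S, MeasurableSpace.comap (Y i) inferInstance] {ω | Y i ω ∉ B} :=
    fun S i hi => by
      have h1 : MeasurableSet[MeasurableSpace.comap (Y i) inferInstance] {ω | Y i ω ∉ B} :=
        ⟨Bᶜ, hB.compl, rfl⟩
      exact le_iSup₂ (f := fun i (_ : i ∈ S) => MeasurableSpace.comap (Y i) inferInstance) i hi _ h1
  have hmeas : ∀ (S : Set ℕ) (k : ℕ), (∀ i < L, k * L + i ∈ S) →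
      MeasurableSet[⨆ i ∈ S, MeasurableSpace.comap (Y i) inferInstance]
        {ω | ∃ i < L, Y (k * L + i) ω ∉ B} := by
    intro S k hS
    have : {ω | ∃ i < L, Y (k * L + i) ω ∉ B} = ⋃ i ∈ Set.Iio L, {ω | Y (k * L + i) ω ∉ B} := by
      ext ω; simp
    rw [this]
    exact MeasurableSet.biUnion (Set.to_countable _) fun i hi => hmem S _ (hS i hi)
  induction m with
  | zero => simp
  | succ m ih =>
    have hset : {ω | ∀ k < m + 1, ∃ i < L, Y (k * L + i) ω ∉ B} =
        {ω | ∀ k < m, ∃ i < L, Y (k * L + i) ω ∉ B} ∩ {ω | ∃ i < L, Y (m * L + i) ω ∉ B} := by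
      ext ω
      simp only [Set.mem_ofPred_eq, Set.mem_inter_iff, Nat.forall_lt_succ_right]
    have hI := indep_iSup_of_disjoint (m := fun i => MeasurableSpace.comap (Y i) inferInstance)
      (fun i => (hY i).comap_le) hind.iIndep
      (S := Set.Iio (m * L)) (T := Set.Ici (m * L))
      (Set.disjoint_left.2 fun x h1 h2 => absurd (Set.mem_Ici.1 h2) (not_le.2 h1))
    have h1 : MeasurableSet[⨆ i ∈ Set.Iio (m * L), MeasurableSpace.comap (Y i) inferInstance]
        {ω | ∀ k < m, ∃ i < L, Y (k * L + i) ω ∉ B} := by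
      have : {ω | ∀ k < m, ∃ i < L, Y (k * L + i) ω ∉ B} =
          ⋂ k ∈ Set.Iio m, {ω | ∃ i < L, Y (k * L + i) ω ∉ B} := by
        ext ω; simp
      rw [this]
      refine MeasurableSet.biInter (Set.to_countable _) fun k hk => hmeas _ _ fun i hi => ?_
      have : (k + 1) * L ≤ m * L := Nat.mul_le_mul_right _ hk
      rw [Set.mem_Iio]
      linarith
    have h2 := hmeas (Set.Ici (m * L)) m fun i _ => by simp
    have h3 := (Indep_iff _ _ P).1 hI _ _ h1 h2
    rw [hset, measureReal_def, h3, ENNReal.toReal_mul, pow_succ]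
    exact mul_le_mul ih (hblock m) ENNReal.toReal_nonneg (pow_nonneg hnn _)

theorem volume_Icc_to_one {a : ℝ} (ha : a < 1) :
    volume (Set.Icc a 1) ≠ 0 ∧ volume (Set.Icc a 1) ≠ ⊤ := by
  simp [ha]

theorem isUniform_ae_mem {a : ℝ} (ha : a < 1) {X : Ω → ℝ}
    (hX : pdf.IsUniform X (Set.Icc a 1) P volume) : ∀ᵐ ω ∂P, X ω ∈ Set.Icc a 1 := by
  have h1 := hX.measure_preimage (volume_Icc_to_one ha).1 (volume_Icc_to_one ha).2
    (A := (Set.Icc a 1)ᶜ) measurableSet_Icc.compl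
  rw [Set.inter_compl_self, measure_empty, ENNReal.zero_div] at h1
  exact h1

/-- The exact probability is `δ / (1 - a)`; dropping the factor is harmless on the logarithmic
scale. -/
theorem isUniform_le_measure_near_one {a δ : ℝ} (ha0 : 0 ≤ a) (ha : a < 1) {X : Ω → ℝ}
    (hX : pdf.IsUniform X (Set.Icc a 1) P volume) (hδ : 0 ≤ δ) (hδa : δ ≤ 1 - a) :
    δ ≤ P.real (X ⁻¹' Set.Ici (1 - δ)) := by
  have h1 := hX.measure_preimage (volume_Icc_to_one ha).1 (volume_Icc_to_one ha).2
    (A := Set.Ici (1 - δ)) measurableSet_Ici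
  have h2 : Set.Icc a 1 ∩ Set.Ici (1 - δ) = Set.Icc (1 - δ) 1 := by
    ext x
    simp only [Set.mem_inter_iff, Set.mem_Icc, Set.mem_Ici]
    constructor
    · rintro ⟨⟨_, h⟩, h'⟩; exact ⟨h', h⟩
    · rintro ⟨h, h'⟩; exact ⟨⟨by linarith, h'⟩, h⟩
  rw [measureReal_def, h1, h2, Real.volume_Icc, Real.volume_Icc, ENNReal.toReal_div,
    ENNReal.toReal_ofReal (by linarith), ENNReal.toReal_ofReal (by linarith),
    le_div_iff₀ (by linarith)]
  nlinarith

theorem isUniform_mgf_le {a t : ℝ} (ha : a < 1) (ht : 0 < t) {X : Ω → ℝ} (hm : Measurable X)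
    (hX : pdf.IsUniform X (Set.Icc a 1) P volume) :
    mgf (fun ω => 1 - X ω) P (-t) ≤ ((1 - a) * t)⁻¹ := by
  have hc : Continuous fun x : ℝ => Real.exp (-t * (1 - x)) := by fun_prop
  have h1 : mgf (fun ω => 1 - X ω) P (-t) = ∫ x, Real.exp (-t * (1 - x)) ∂(P.map X) :=
    (integral_map hm.aemeasurable hc.aestronglyMeasurable).symm
  have h2 : ∫ x in a..1, Real.exp (-t * (1 - x)) =
      Real.exp (-t * (1 - 1)) / t - Real.exp (-t * (1 - a)) / t := by
    refine intervalIntegral.integral_eq_sub_of_hasDerivAt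
      (f := fun x => Real.exp (-t * (1 - x)) / t) (fun x _ => ?_) (hc.intervalIntegrable _ _)
    have h3 : HasDerivAt (fun x : ℝ => -t * (1 - x)) t x := by
      simpa using ((hasDerivAt_id x).const_sub 1).const_mul (-t)
    have h4 := h3.exp.div_const t
    rwa [mul_div_assoc, div_self ht.ne', mul_one] at h4
  rw [h1, hX, ProbabilityTheory.cond, integral_smul_measure, integral_Icc_eq_integral_Ioc,
    ← intervalIntegral.integral_of_le ha.le, h2, Real.volume_Icc, ENNReal.toReal_inv,
    ENNReal.toReal_ofReal (by linarith), smul_eq_mul, mul_inv]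
  refine mul_le_mul_of_nonneg_left ?_ (inv_nonneg.2 (by linarith))
  have : 0 ≤ Real.exp (-t * (1 - a)) / t := by positivity
  simpa using this

/-- Chernoff bound for the total disorder in a set of couplings. -/
theorem measure_sum_disorder_le [IsProbabilityMeasure P] {a t μ : ℝ} (ha : a < 1) (ht : 0 < t) {Y : ℕ → Ω → ℝ}
    (hind : iIndepFun Y P) (hY : ∀ i, Measurable (Y i))
    (hunif : ∀ i, pdf.IsUniform (Y i) (Set.Icc a 1) P volume) (s : Finset ℕ) :
    P.real {ω | ∑ i ∈ s, (1 - Y i ω) ≤ μ} ≤ Real.exp (t * μ) * (((1 - a) * t)⁻¹) ^ s.card := by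
  have hZ : iIndepFun (fun i ω => 1 - Y i ω) P :=
    hind.comp (fun _ x => 1 - x) fun _ => by fun_prop
  have hZm : ∀ i, Measurable fun ω => 1 - Y i ω := fun i => (hY i).const_sub 1
  have hint : Integrable (fun ω => Real.exp (-t * (∑ i ∈ s, fun ω => 1 - Y i ω) ω)) P :=
    hZ.integrable_exp_mul_sum hZm fun i _ => by
      refine integrable_exp_mul_of_mem_Icc (a := 0) (b := 1 - a) (hZm i).aemeasurable ?_
      filter_upwards [isUniform_ae_mem ha (hunif i)] with ω hω
      exact ⟨by linarith [hω.2], by linarith [hω.1]⟩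
  have h1 := measure_le_le_exp_mul_mgf (X := ∑ i ∈ s, fun ω => 1 - Y i ω) μ
    (by linarith : -t ≤ 0) hint
  rw [hZ.mgf_sum hZm] at h1
  have h2 : ∏ i ∈ s, mgf (fun ω => 1 - Y i ω) P (-t) ≤ ∏ _i ∈ s, ((1 - a) * t)⁻¹ :=
    Finset.prod_le_prod (fun _ _ => mgf_nonneg) fun i _ => isUniform_mgf_le ha ht (hY i) (hunif i)
  rw [Finset.prod_const] at h2
  simp only [neg_neg, Finset.sum_apply] at h1
  exact h1.trans (mul_le_mul_of_nonneg_left h2 (Real.exp_nonneg _))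

/-- The Borel–Cantelli lemma for a sequence of events dominated by a summable real sequence. -/
theorem ae_eventually_notMem_of_summable [IsProbabilityMeasure P] {s : ℕ → Set Ω} {g : ℕ → ℝ} (hg : Summable g)
    (hs : ∀ᶠ n in atTop, P.real (s n) ≤ g n) : ∀ᵐ ω ∂P, ∀ᶠ n in atTop, ω ∉ s n := by
  have hsum : Summable fun n => P.real (s n) := by
    refine Summable.of_norm_bounded_eventually_nat hg ?_
    filter_upwards [hs] with n hn
    rwa [Real.norm_of_nonneg measureReal_nonneg]
  refine ae_eventually_notMem ?_
  have h1 : ∀ n, P (s n) = ENNReal.ofReal (P.real (s n)) := fun n => by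
    rw [measureReal_def, ENNReal.ofReal_toReal (measure_ne_top _ _)]
  simp_rw [h1]
  exact hsum.tsum_ofReal_ne_top

end Probability

/-! ### Asymptotics of the length scale -/

theorem tendsto_log_natCast : Tendsto (fun N : ℕ => Real.log N) atTop atTop :=
  Real.tendsto_log_atTop.comp tendsto_natCast_atTop_atTop

theorem tendsto_lengthScale_div_log :
    Tendsto (fun N : ℕ => lengthScale N / Real.log N) atTop (𝓝 0) := by
  have h1 : Tendsto (fun x : ℝ => (2 * Real.log x)⁻¹) atTop (𝓝 0) :=
    (Real.tendsto_log_atTop.const_mul_atTop two_pos).inv_tendsto_atTop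
  refine (h1.comp tendsto_log_natCast).congr' ?_
  filter_upwards [tendsto_log_natCast.eventually_gt_atTop 0] with N hN
  simp only [Function.comp_apply, lengthScale]
  field_simp

theorem tendsto_lengthScale : Tendsto lengthScale atTop atTop := by
  have h0 : Tendsto (fun x : ℝ => Real.log x / x) atTop (𝓝[>] 0) := by
    refine tendsto_nhdsWithin_iff.2 ⟨Real.isLittleO_log_id_atTop.tendsto_div_nhds_zero, ?_⟩
    filter_upwards [eventually_gt_atTop 1] with x hx
    exact div_pos (Real.log_pos hx) (by linarith)
  have h1 : Tendsto (fun x : ℝ => x / (2 * Real.log x)) atTop atTop := by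
    refine (h0.inv_tendsto_nhdsGT_zero.const_mul_atTop (by norm_num : (0 : ℝ) < 1 / 2)).congr
      fun x => ?_
    simp only [Pi.inv_apply, inv_div]
    ring
  exact h1.comp tendsto_log_natCast

/-- With `y = log log N` the quotient is `log T / y = 1 - log 2 / y - log y / y`. This relation
fixes the constant in the length scale. -/
theorem tendsto_lengthScale_mul_log :
    Tendsto (fun N : ℕ => 2 * lengthScale N * Real.log (lengthScale N) / Real.log N) atTop
      (𝓝 1) := by
  have h0 : Tendsto (fun x : ℝ => Real.log x / x) atTop (𝓝 0) :=
    Real.isLittleO_log_id_atTop.tendsto_div_nhds_zero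
  have h1 : Tendsto (fun y : ℝ => 1 - Real.log 2 / y - Real.log y / y) atTop (𝓝 (1 - 0 - 0)) :=
    (tendsto_const_nhds.sub (tendsto_const_nhds.div_atTop tendsto_id)).sub h0
  rw [sub_zero, sub_zero] at h1
  refine (h1.comp (Real.tendsto_log_atTop.comp tendsto_log_natCast)).congr' ?_
  filter_upwards [tendsto_log_natCast.eventually_gt_atTop 1] with N hN
  have hl : 0 < Real.log (Real.log N) := Real.log_pos hN
  have hx : 0 < Real.log N := by linarith
  simp only [Function.comp_apply, lengthScale]
  rw [Real.log_div hx.ne' (by positivity), Real.log_mul two_ne_zero hl.ne']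
  field_simp
  ring

theorem eventually_lengthScale_mono :
    ∀ᶠ j : ℕ in atTop, ∀ N, j ≤ N → lengthScale j ≤ lengthScale N := by
  filter_upwards [tendsto_log_natCast.eventually_ge_atTop (Real.exp 1), eventually_gt_atTop 0]
    with j hj hj0 N hjN
  have h1 : Real.log j ≤ Real.log N :=
    Real.log_le_log (by exact_mod_cast hj0) (by exact_mod_cast hjN)
  have h2 := Real.log_div_self_antitoneOn (a := Real.log j) (b := Real.log N) hj (hj.trans h1) h1
  have h3 : (1 : ℝ) < Real.exp 1 := by simp
  have hN : 0 < Real.log (Real.log N) := Real.log_pos (by linarith)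
  have hJ : 0 < Real.log (Real.log j) := Real.log_pos (by linarith)
  have hx : 0 < Real.log (j : ℝ) := by linarith
  have hy : 0 < Real.log (N : ℝ) := by linarith
  simp only at h2
  rw [div_le_div_iff₀ hy hx] at h2
  rw [lengthScale, lengthScale, div_le_div_iff₀ (by positivity) (by positivity)]
  linarith

theorem eventually_chernoff_exponent_le {ε : ℝ} (hε : 0 < ε) (c : ℝ) :
    ∀ᶠ N : ℕ in atTop, lengthScale N - (1 + ε) * lengthScale N *
      (c + 2 * Real.log (lengthScale N)) ≤ -((1 + ε / 2) * Real.log N) := by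
  have h1 : Tendsto (fun N : ℕ => lengthScale N / Real.log N * (1 - (1 + ε) * c) -
      (1 + ε) * (2 * lengthScale N * Real.log (lengthScale N) / Real.log N)) atTop
      (𝓝 (0 * (1 - (1 + ε) * c) - (1 + ε) * 1)) :=
    (tendsto_lengthScale_div_log.mul_const _).sub (tendsto_lengthScale_mul_log.const_mul _)
  filter_upwards [h1.eventually_le_const (u := -(1 + ε / 2)) (by linarith),
    tendsto_log_natCast.eventually_gt_atTop 0] with N hN hx
  have h2 := mul_le_mul_of_nonneg_right hN hx.le
  have h3 : (lengthScale N / Real.log N * (1 - (1 + ε) * c) -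
      (1 + ε) * (2 * lengthScale N * Real.log (lengthScale N) / Real.log N)) * Real.log N =
      lengthScale N - (1 + ε) * lengthScale N * (c + 2 * Real.log (lengthScale N)) := by
    field_simp
    ring
  linarith

theorem eventually_block_exponent_le {ε : ℝ} (hε : 0 < ε) (c : ℝ) :
    ∀ᶠ N : ℕ in atTop, (1 - ε) * lengthScale N * (c + 2 * Real.log (lengthScale N)) ≤
      (1 - ε / 2) * Real.log N := by
  have h1 : Tendsto (fun N : ℕ => lengthScale N / Real.log N * ((1 - ε) * c) +
      (1 - ε) * (2 * lengthScale N * Real.log (lengthScale N) / Real.log N)) atTop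
      (𝓝 (0 * ((1 - ε) * c) + (1 - ε) * 1)) :=
    (tendsto_lengthScale_div_log.mul_const _).add (tendsto_lengthScale_mul_log.const_mul _)
  filter_upwards [h1.eventually_le_const (u := (1 - ε / 2)) (by linarith),
    tendsto_log_natCast.eventually_gt_atTop 0] with N hN hx
  have h2 := mul_le_mul_of_nonneg_right hN hx.le
  have h3 : (lengthScale N / Real.log N * ((1 - ε) * c) +
      (1 - ε) * (2 * lengthScale N * Real.log (lengthScale N) / Real.log N)) * Real.log N =
      (1 - ε) * lengthScale N * (c + 2 * Real.log (lengthScale N)) := by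
    field_simp
  linarith

/-! ### Almost sure statements via Borel–Cantelli -/

section Probability

variable {Ω : Type*} [MeasurableSpace Ω] {P : Measure Ω}

/-- Almost surely, eventually every stretch of slightly more than `lengthScale N` couplings below
`N` carries much disorder. -/
theorem ae_eventually_disorder_ge [IsProbabilityMeasure P] {a ε : ℝ} (ha : a < 1) (hε : 0 < ε)
    {Y : ℕ → Ω → ℝ} (hind : iIndepFun Y P) (hY : ∀ i, Measurable (Y i))
    (hunif : ∀ i, pdf.IsUniform (Y i) (Set.Icc a 1) P volume) :
    ∀ᵐ ω ∂P, ∀ᶠ N : ℕ in atTop, ∀ p, p + ⌈(1 + ε) * lengthScale N⌉₊ + 1 ≤ N →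
      1 / (ε * lengthScale N) ≤
        ∑ i ∈ Finset.range ⌈(1 + ε) * lengthScale N⌉₊, (1 - Y (p + i) ω) := by
  set L : ℕ → ℕ := fun j => ⌈(1 + ε) * lengthScale j⌉₊
  have hLtop : Tendsto L atTop atTop :=
    tendsto_nat_ceil_atTop.comp (tendsto_lengthScale.const_mul_atTop (by linarith))
  -- One event per right endpoint `j` replaces a union over all windows below `N`, so a bound `j ^
  -- (-(1 + ε / 2))` is already summable.
  have hbad : ∀ᵐ ω ∂P, ∀ᶠ j : ℕ in atTop, ω ∉ {ω | ∑ i ∈ Finset.range (L j),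
      (1 - Y (j - 1 - L j + i) ω) ≤ 1 / (ε * lengthScale j)} := by
    refine ae_eventually_notMem_of_summable
      (g := fun j : ℕ => (j : ℝ) ^ (-(1 + ε / 2))) (Real.summable_nat_rpow.2 (by linarith)) ?_
    have hc : 0 < (1 - a) * ε := mul_pos (by linarith) hε
    filter_upwards [eventually_chernoff_exponent_le hε (Real.log ((1 - a) * ε)),
      tendsto_lengthScale.eventually_gt_atTop 0, eventually_gt_atTop 0,
      ((tendsto_pow_atTop two_ne_zero).comp tendsto_lengthScale).eventually_ge_atTop
        (1 / ((1 - a) * ε))] with j hexp hT hj hT2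
    simp only [Function.comp_apply] at hT2
    set T := lengthScale j
    have ht : 0 < ε * T ^ 2 := by positivity
    -- With `t = ε T ^ 2` the cost `exp (t μ)` is only `exp T`, while each coupling gains a factor
    -- of order `T⁻²`.
    have h1 := measure_sum_disorder_le (P := P) (μ := 1 / (ε * T)) ha ht hind hY hunif
      ((Finset.range (L j)).map (addLeftEmbedding (j - 1 - L j)))
    simp only [Finset.sum_map, addLeftEmbedding_apply, Finset.card_map, Finset.card_range] at h1
    refine h1.trans ?_
    have h2 : ε * T ^ 2 * (1 / (ε * T)) = T := by field_simp
    have hb1 : 1 ≤ (1 - a) * ε * T ^ 2 := by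
      rwa [div_le_iff₀ hc, mul_comm] at hT2
    have h3 : (((1 - a) * (ε * T ^ 2))⁻¹) ^ L j =
        Real.exp (-(L j * (Real.log ((1 - a) * ε) + 2 * Real.log T))) := by
      rw [← mul_assoc, ← mul_neg, Real.exp_nat_mul, Real.exp_neg, Real.exp_add,
        Real.exp_log hc, two_mul, Real.exp_add, Real.exp_log hT, ← sq]
    have h4 : 0 ≤ Real.log ((1 - a) * ε) + 2 * Real.log T := by
      have := Real.log_nonneg hb1
      rw [Real.log_mul hc.ne' (by positivity), Real.log_pow] at this
      exact_mod_cast this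
    have h5 : (1 + ε) * T ≤ L j := Nat.le_ceil _
    have h6 := mul_le_mul_of_nonneg_right h5 h4
    rw [h2, h3, ← Real.exp_add, Real.rpow_def_of_pos (by exact_mod_cast hj)]
    exact Real.exp_le_exp.2 (by linarith)
  have hle : ∀ᵐ ω ∂P, ∀ i, Y i ω ≤ 1 := ae_all_iff.2 fun i => by
    filter_upwards [isUniform_ae_mem ha (hunif i)] with ω hω using hω.2
  filter_upwards [hbad, hle] with ω hω hω1
  obtain ⟨j₀, hj₀⟩ := eventually_atTop.1 (hω.and (eventually_lengthScale_mono.and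
    (tendsto_lengthScale.eventually_gt_atTop 0)))
  filter_upwards [hLtop.eventually_ge_atTop j₀] with N hN p hpN
  -- The window for `N` contains the shorter one of length `L j` with the same right end, and the
  -- threshold for `j` is the larger; `j > L N` keeps `j` large even for small `p`.
  obtain ⟨hj, hmono, hpos⟩ := hj₀ (p + L N + 1) (by omega)
  set j := p + L N + 1
  have hT := hmono N hpN
  have hL : L j ≤ L N := Nat.ceil_le_ceil (mul_le_mul_of_nonneg_left hT (by linarith))
  rw [not_le] at hj
  obtain ⟨d, hd⟩ := Nat.exists_eq_add_of_le' hL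
  change _ ≤ ∑ i ∈ Finset.range (L N), (1 - Y (p + i) ω)
  rw [hd, Finset.sum_range_add]
  have h1 : 0 ≤ ∑ i ∈ Finset.range d, (1 - Y (p + i) ω) :=
    Finset.sum_nonneg fun i _ => by linarith [hω1 (p + i)]
  have h2 : j - 1 - L j = p + d := by omega
  rw [h2] at hj
  simp only [← add_assoc]
  have h3 : 1 / (ε * lengthScale N) ≤ 1 / (ε * lengthScale j) :=
    one_div_le_one_div_of_le (by positivity) (mul_le_mul_of_nonneg_left hT hε.le)
  linarith

/-- Almost surely, eventually there is a stretch of slightly less than `lengthScale N` strong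
couplings below `N`. -/
theorem ae_eventually_exists_stretch [IsProbabilityMeasure P] {a ε : ℝ} (ha0 : 0 ≤ a) (ha : a < 1)
    (hε : 0 < ε) (hε1 : ε < 1) {Y : ℕ → Ω → ℝ} (hind : iIndepFun Y P)
    (hY : ∀ i, Measurable (Y i)) (hunif : ∀ i, pdf.IsUniform (Y i) (Set.Icc a 1) P volume) :
    ∀ᵐ ω ∂P, ∀ᶠ N : ℕ in atTop, ∃ p, p + ⌊(1 - ε) * lengthScale N⌋₊ + 1 ≤ N ∧
      ∀ i < ⌊(1 - ε) * lengthScale N⌋₊, 1 - ε / lengthScale N ^ 2 ≤ Y (p + i) ω := by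
  set L : ℕ → ℕ := fun N => ⌊(1 - ε) * lengthScale N⌋₊
  -- About `N ^ (1 - ε / 4)` blocks: few enough that they fit below `N`, yet enough to beat the
  -- success probability `N ^ (-(1 - ε / 2))`, with expected count at least `2 log N` and so failure
  -- probability at most `N ^ (-2)`.
  set m : ℕ → ℕ := fun N => ⌊Real.exp ((1 - ε / 4) * Real.log N)⌋₊
  have hexp : Tendsto (fun x : ℝ => x / Real.exp (ε / 4 * x)) atTop (𝓝 0) := by
    have := (isLittleO_pow_exp_pos_mul_atTop 1 (by linarith : 0 < ε / 4)).tendsto_div_nhds_zero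
    simpa using this
  have hexp4 := (hexp.comp tendsto_log_natCast).eventually_le_const
    (by norm_num : (0 : ℝ) < 1 / 4)
  have hbad : ∀ᵐ ω ∂P, ∀ᶠ N : ℕ in atTop, ω ∉ {ω | ∀ k < m N, ∃ i < L N,
      Y (k * L N + i) ω ∉ Set.Ici (1 - ε / lengthScale N ^ 2)} := by
    refine ae_eventually_notMem_of_summable
      (g := fun j : ℕ => (j : ℝ) ^ (-2 : ℝ)) (Real.summable_nat_rpow.2 (by norm_num)) ?_
    filter_upwards [eventually_block_exponent_le hε (-Real.log ε),
      tendsto_lengthScale.eventually_ge_atTop 1, eventually_gt_atTop 0, hexp4,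
      tendsto_log_natCast.eventually_ge_atTop (4 / 3),
      ((tendsto_pow_atTop two_ne_zero).comp tendsto_lengthScale).eventually_ge_atTop
        (ε / (1 - a))] with N hex hT hN hx4 hx hT2
    simp only [Function.comp_apply] at hT2 hx4
    set T := lengthScale N
    set x := Real.log N
    have hT0 : 0 < T := by linarith
    have hδ : 0 < ε / T ^ 2 := by positivity
    have hδa : ε / T ^ 2 ≤ 1 - a := by
      rw [div_le_iff₀ (by linarith)] at hT2
      rw [div_le_iff₀ (by positivity)]
      linarith
    have h1 := measure_no_good_block_le hind hY (B := Set.Ici (1 - ε / T ^ 2)) measurableSet_Ici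
      (fun i => isUniform_le_measure_near_one ha0 ha (hunif i) hδ.le hδa) hδ.le (L N) (m N)
    refine h1.trans ?_
    have h2 : (ε / T ^ 2) ^ L N = Real.exp (-(L N * (-Real.log ε + 2 * Real.log T))) := by
      rw [← mul_neg, Real.exp_nat_mul, neg_add, neg_neg, ← sub_eq_add_neg, Real.exp_sub,
        Real.exp_log hε, two_mul, Real.exp_add, Real.exp_log hT0, ← sq]
    have h3 : 0 ≤ -Real.log ε + 2 * Real.log T := by
      have := Real.log_nonpos hε.le hε1.le
      have := Real.log_nonneg hT
      linarith
    have h4 : (L N : ℝ) ≤ (1 - ε) * T := Nat.floor_le (mul_nonneg (by linarith) hT0.le)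
    have h5 := mul_le_mul_of_nonneg_right h4 h3
    have h6 : Real.exp (-((1 - ε / 2) * x)) ≤ (ε / T ^ 2) ^ L N := by
      rw [h2]
      exact Real.exp_le_exp.2 (by linarith)
    have h7 : Real.exp ((1 - ε / 4) * x) / 2 ≤ m N := by
      have h8 := Nat.lt_floor_add_one (Real.exp ((1 - ε / 4) * x))
      have h9 : (1 - ε / 4) * x + 1 ≤ Real.exp ((1 - ε / 4) * x) := Real.add_one_le_exp _
      have h10 : 1 ≤ (1 - ε / 4) * x := by nlinarith
      have h11 : (m N : ℝ) = ⌊Real.exp ((1 - ε / 4) * x)⌋₊ := rfl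
      linarith
    have h8 : 2 * x ≤ m N * (ε / T ^ 2) ^ L N := by
      have h9 : Real.exp ((1 - ε / 4) * x) / 2 * Real.exp (-((1 - ε / 2) * x)) =
          Real.exp (ε / 4 * x) / 2 := by
        rw [div_mul_eq_mul_div, ← Real.exp_add]
        ring_nf
      rw [div_le_iff₀ (Real.exp_pos _)] at hx4
      have h10 := mul_le_mul h7 h6 (Real.exp_nonneg _) (Nat.cast_nonneg _)
      linarith
    have h12 : (ε / T ^ 2) ^ L N ≤ 1 := by
      rw [h2]
      exact Real.exp_le_one_iff.2 (neg_nonpos.2 (mul_nonneg (Nat.cast_nonneg _) h3))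
    calc (1 - (ε / T ^ 2) ^ L N) ^ m N ≤ (Real.exp (-(ε / T ^ 2) ^ L N)) ^ m N :=
          pow_le_pow_left₀ (by linarith) (Real.one_sub_le_exp_neg _) _
      _ = Real.exp (m N * (-(ε / T ^ 2) ^ L N)) := (Real.exp_nat_mul _ _).symm
      _ ≤ (N : ℝ) ^ (-2 : ℝ) := by
        rw [Real.rpow_def_of_pos (by exact_mod_cast hN)]
        exact Real.exp_le_exp.2 (by linarith)
  filter_upwards [hbad] with ω hω
  filter_upwards [hω, hexp4, tendsto_log_natCast.eventually_ge_atTop 1, eventually_gt_atTop 0,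
    tendsto_lengthScale.eventually_ge_atTop 0,
    tendsto_lengthScale_div_log.eventually_le_const one_pos] with N hgood hx4 hx hN hT hTx
  simp only [not_forall, not_exists, not_and, not_not, Set.mem_Ici] at hgood
  obtain ⟨k, hk, hkg⟩ := hgood
  refine ⟨k * L N, ?_, hkg⟩
  simp only [Function.comp_apply] at hx4
  set T := lengthScale N
  set x := Real.log N
  have hNx : (N : ℝ) = Real.exp x := (Real.exp_log (by exact_mod_cast hN)).symm
  have h1 : (L N : ℝ) ≤ x := by
    have h2 : (L N : ℝ) ≤ (1 - ε) * T := Nat.floor_le (mul_nonneg (by linarith) hT)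
    rw [div_le_one (by linarith)] at hTx
    nlinarith
  have h2 : (m N : ℝ) ≤ Real.exp ((1 - ε / 4) * x) := Nat.floor_le (Real.exp_nonneg _)
  rw [div_le_iff₀ (Real.exp_pos _)] at hx4
  have h3 : (m N : ℝ) * L N + 1 ≤ N := by
    have h4 := mul_le_mul h2 (h1.trans hx4) (Nat.cast_nonneg _) (Real.exp_nonneg _)
    have h5 : Real.exp ((1 - ε / 4) * x) * (1 / 4 * Real.exp (ε / 4 * x)) = Real.exp x / 4 := by
      rw [mul_left_comm, ← Real.exp_add]
      ring_nf
    have h6 := Real.add_one_le_exp x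
    rw [hNx]
    linarith
  have h4 : m N * L N + 1 ≤ N := by exact_mod_cast h3
  have h5 : (k + 1) * L N ≤ m N * L N := Nat.mul_le_mul_right _ hk
  change k * L N + L N + 1 ≤ N
  linarith

end Probability

/-! ### Bounds in units of the length scale, and the limits -/

theorem hoppingMatrix_congr {b b' : ℕ → ℝ} (h : ∀ j, 2 ≤ j → b j = b' j) (N : ℕ) :
    hoppingMatrix b N = hoppingMatrix b' N := by
  ext i j
  simp only [hoppingMatrix, Matrix.of_apply]
  split_ifs
  · rfl
  · rw [h _ (by omega)]
  · rw [h _ (by omega)]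
  · rfl

/-- The upper bound for the landscape function when stretches of length `(1 + ε) T` are disordered,
in units of `T ^ 2`. -/
theorem norm_landscape_div_le {b : ℕ → ℝ} {N : ℕ} {T ε : ℝ} (hN : 1 ≤ N)
    (hb : ∀ n, b n ∈ Set.Icc (0 : ℝ) 1) (hε : 0 < ε) (hε1 : ε < 1 / 2) (hT : 1 ≤ T)
    (hεT : 2 ≤ ε * T)
    (hwin : ∀ p, 1 ≤ p → p + ⌈(1 + ε) * T⌉₊ ≤ N →
      1 / (ε * T) ≤ ∑ j ∈ Finset.range ⌈(1 + ε) * T⌉₊, (1 - b (p + j + 1))) :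
    ‖landscape b N‖ / T ^ 2 ≤ (5 * ε + (1 + 2 * ε) ^ 2 / 8) / (1 - 2 * ε) := by
  set M := ‖landscape b N‖
  set L := ⌈(1 + ε) * T⌉₊
  have hT0 : 0 < T := by linarith
  have hM : 0 ≤ M := norm_nonneg _
  obtain ⟨m, hm⟩ : ∃ m, m = M / T ^ 2 := ⟨_, rfl⟩
  have hMm : M = m * T ^ 2 := by rw [hm]; field_simp
  have hm0 : 0 ≤ m := by rw [hm]; positivity
  have hL : (L : ℝ) + 1 ≤ (1 + 2 * ε) * T := by
    have h1 : (L : ℝ) < (1 + ε) * T + 1 := Nat.ceil_lt_add_one (by positivity)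
    linarith
  have hsqrt : √(2 * M + 1) ≤ (m + 1) * T := by
    refine Real.sqrt_le_iff.2 ⟨by positivity, ?_⟩
    rw [hMm]
    nlinarith [sq_nonneg (m * T), sq_nonneg (T - 1)]
  have hX : 0 < (L : ℝ) + 1 + 2 * √(2 * M + 1) := by positivity
  -- This `h` is twice what the disorder condition needs. It depends on `M`, but only through `ε (5
  -- + 2 m) T ^ 2`, which is absorbed on the left and produces the denominator `1 - 2 ε`.
  have key := norm_landscape_le (h := ε * T * (L + 1 + 2 * √(2 * M + 1))) hN hb (by positivity)
    hwin (by
      have h1 : 2 * (ε * T * (L + 1 + 2 * √(2 * M + 1))) * (1 / (ε * T)) =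
          2 * (L + 1 + 2 * √(2 * M + 1)) := by field_simp
      rw [h1]
      linarith)
  have h2 : ε * T * (L + 1 + 2 * √(2 * M + 1)) ≤ ε * T * ((5 + 2 * m) * T) := by
    refine mul_le_mul_of_nonneg_left ?_ (by positivity)
    nlinarith
  have h3 : ((L : ℝ) + 1) ^ 2 ≤ ((1 + 2 * ε) * T) ^ 2 := pow_le_pow_left₀ (by positivity) hL 2
  rw [← hm, le_div_iff₀ (by linarith)]
  have h4 : m * T ^ 2 ≤ (ε * (5 + 2 * m) + (1 + 2 * ε) ^ 2 / 8) * T ^ 2 := by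
    change M ≤ _ at key
    rw [← hMm]
    linarith
  have h5 := le_of_mul_le_mul_right h4 (by positivity)
  linarith

theorem bounds_of_stretch {b : ℕ → ℝ} {N p : ℕ} {T ε : ℝ}
    (hb : ∀ n, b n ∈ Set.Icc (0 : ℝ) 1) (hε : 0 < ε) (hε1 : ε < 1 / 2) (hT : 1 ≤ T)
    (hεT : 1 ≤ ε * T) (hT2 : 2 ≤ (1 - 2 * ε) * T) (hpN : p + ⌊(1 - ε) * T⌋₊ ≤ N)
    (hstretch : ∀ n, p < n → n ≤ p + ⌊(1 - ε) * T⌋₊ → 1 - ε / T ^ 2 ≤ b n) :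
    ((1 - 2 * ε) ^ 2 - ε) / (8 * (1 + ε / 4)) ≤ ‖landscape b N‖ / T ^ 2 ∧
      groundEnergy b N * T ^ 2 ≤ Real.pi ^ 2 / (1 - 2 * ε) ^ 2 + 2 * ε := by
  set L := ⌊(1 - ε) * T⌋₊
  have hT0 : 0 < T := by linarith
  have hL : (1 - 2 * ε) * T ≤ L := by
    have h1 : (1 - ε) * T < L + 1 := Nat.lt_floor_add_one _
    linarith
  have hL' : (L : ℝ) ≤ T := by
    have h1 : (L : ℝ) ≤ (1 - ε) * T := Nat.floor_le (mul_nonneg (by linarith) hT0.le)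
    nlinarith
  have hLsq := pow_le_pow_left₀ (by linarith) hL 2
  have hδ : 0 ≤ ε / T ^ 2 := by positivity
  constructor
  · have h1 := le_norm_landscape hb hδ hpN hstretch
    have h2 : ε / T ^ 2 * (L : ℝ) ^ 2 / 4 ≤ ε / 4 := by
      have h3 : (L : ℝ) ^ 2 ≤ T ^ 2 := pow_le_pow_left₀ (Nat.cast_nonneg _) hL' 2
      have h4 := mul_le_mul_of_nonneg_left h3 hδ
      rw [div_mul_cancel₀ _ (by positivity)] at h4
      linarith
    have h3 := mul_le_mul_of_nonneg_right (by linarith : 1 + ε / T ^ 2 * (L : ℝ) ^ 2 / 4 ≤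
      1 + ε / 4) (norm_nonneg (landscape b N))
    rw [div_le_div_iff₀ (by positivity) (by positivity)]
    have h4 : 1 ≤ ε * T ^ 2 := by nlinarith
    linarith
  · have h1 := groundEnergy_le hb hδ (by exact_mod_cast hT2.trans hL) hpN hstretch
    have h2 : (Real.pi / L) ^ 2 ≤ Real.pi ^ 2 / ((1 - 2 * ε) * T) ^ 2 := by
      rw [div_pow]
      exact div_le_div_of_nonneg_left (by positivity) (by positivity) hLsq
    calc groundEnergy b N * T ^ 2
        ≤ (Real.pi ^ 2 / ((1 - 2 * ε) * T) ^ 2 + 2 * (ε / T ^ 2)) * T ^ 2 :=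
          mul_le_mul_of_nonneg_right (by linarith) (by positivity)
      _ = _ := by
        have : 1 - 2 * ε ≠ 0 := by linarith
        field_simp

theorem ae_eventually_bounds {Ω : Type*} [MeasurableSpace Ω] (P : Measure Ω)
    [IsProbabilityMeasure P] (a : ℝ) (ha0 : 0 ≤ a) (ha1 : a < 1) (X : ℕ → Ω → ℝ)
    (hmeas : ∀ j, 2 ≤ j → Measurable (X j))
    (hindep : iIndepFun (fun (j : Set.Ici (2 : ℕ)) => X (j : ℕ)) P)
    (hunif : ∀ j, 2 ≤ j → pdf.IsUniform (X j) (Set.Icc a 1) P volume) {ε : ℝ} (hε : 0 < ε)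
    (hε1 : ε < 1 / 2) :
    ∀ᵐ ω ∂P, ∀ᶠ N : ℕ in atTop,
      (0 < lengthScale N ∧ 0 < groundEnergy (fun j => X j ω) N ∧
        1 ≤ groundEnergy (fun j => X j ω) N * ‖landscape (fun j => X j ω) N‖) ∧
      ‖landscape (fun j => X j ω) N‖ / lengthScale N ^ 2 ≤
        (5 * ε + (1 + 2 * ε) ^ 2 / 8) / (1 - 2 * ε) ∧
      ((1 - 2 * ε) ^ 2 - ε) / (8 * (1 + ε / 4)) ≤
        ‖landscape (fun j => X j ω) N‖ / lengthScale N ^ 2 ∧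
      groundEnergy (fun j => X j ω) N * lengthScale N ^ 2 ≤
        Real.pi ^ 2 / (1 - 2 * ε) ^ 2 + 2 * ε := by
  set Y : ℕ → Ω → ℝ := fun i => X (i + 2)
  have hY : ∀ i, Measurable (Y i) := fun i => hmeas _ (by omega)
  have hYu : ∀ i, pdf.IsUniform (Y i) (Set.Icc a 1) P volume := fun i => hunif _ (by omega)
  have hYi : iIndepFun Y P :=
    hindep.precomp (g := fun i : ℕ => (⟨i + 2, Nat.le_add_left 2 i⟩ : Set.Ici (2 : ℕ)))
      fun i j h => by have := congrArg Subtype.val h; simp only at this; omega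
  have hmem : ∀ᵐ ω ∂P, ∀ i, Y i ω ∈ Set.Icc a 1 :=
    ae_all_iff.2 fun i => isUniform_ae_mem ha1 (hYu i)
  filter_upwards [hmem, ae_eventually_disorder_ge ha1 hε hYi hY hYu,
    ae_eventually_exists_stretch ha0 ha1 hε (by linarith) hYi hY hYu] with ω hω hup hlow
  -- Nothing is known about `X 0` and `X 1`, and the matrix never sees them; the value `0` puts
  -- every coupling in `[0, 1]`.
  set b : ℕ → ℝ := fun j => if 2 ≤ j then X j ω else 0
  have hbX : ∀ N, hoppingMatrix (fun j => X j ω) N = hoppingMatrix b N :=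
    hoppingMatrix_congr fun j hj => by simp [b, hj]
  have hbY : ∀ n i, n = i + 2 → b n = Y i ω := fun n i h => by simp [b, Y, h]
  have hb : ∀ n, b n ∈ Set.Icc (0 : ℝ) 1 := fun n => by
    by_cases h : 2 ≤ n
    · rw [hbY n (n - 2) (by omega)]
      exact ⟨ha0.trans (hω _).1, (hω _).2⟩
    · simp [b, h]
  have hu : ∀ N, landscape (fun j => X j ω) N = landscape b N := fun N => by
    rw [landscape, landscape, hbX]
  have hE : ∀ N, groundEnergy (fun j => X j ω) N = groundEnergy b N := fun N => by
    rw [groundEnergy, groundEnergy, hbX]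
  filter_upwards [hup, hlow, tendsto_lengthScale.eventually_ge_atTop 1,
    (tendsto_lengthScale.const_mul_atTop hε).eventually_ge_atTop 2,
    (tendsto_lengthScale.const_mul_atTop (by linarith : 0 < 1 - 2 * ε)).eventually_ge_atTop 2,
    eventually_ge_atTop 1] with N hup hlow hT hεT hT2 hN
  rw [hu, hE]
  obtain ⟨p, hpN, hp⟩ := hlow
  refine ⟨⟨by linarith, one_le_groundEnergy_mul_norm hN hb⟩,
    norm_landscape_div_le hN hb hε hε1 hT hεT fun q hq hqN => ?_,
    bounds_of_stretch (p := p + 1) hb hε hε1 hT (by linarith) hT2 (by omega) fun n h1 h2 => ?_⟩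
  · refine (hup (q - 1) (by omega)).trans_eq (Finset.sum_congr rfl fun i _ => ?_)
    rw [hbY (q + i + 1) (q - 1 + i) (by omega)]
  · rw [hbY n (p + (n - p - 2)) (by omega)]
    exact hp _ (by omega)

theorem mainTheorem2 {Ω : Type*} [MeasurableSpace Ω] (P : Measure Ω) [IsProbabilityMeasure P]
    (a : ℝ) (ha0 : 0 ≤ a) (ha1 : a < 1) (X : ℕ → Ω → ℝ)
    (hmeas : ∀ j, 2 ≤ j → Measurable (X j))
    (hindep : iIndepFun (fun (j : Set.Ici (2 : ℕ)) => X (j : ℕ)) P)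
    (hunif : ∀ j, 2 ≤ j → pdf.IsUniform (X j) (Set.Icc a 1) P volume) :
    (∀ᵐ ω ∂P, Tendsto
      (fun N : ℕ => ‖landscape (fun j => X j ω) N‖ / lengthScale N ^ 2) atTop (𝓝 (1 / 8))) ∧
    (∀ᵐ ω ∂P,
      (8 : EReal) ≤ liminf (fun N : ℕ =>
        ((groundEnergy (fun j => X j ω) N * lengthScale N ^ 2 : ℝ) : EReal)) atTop ∧
      liminf (fun N : ℕ =>
        ((groundEnergy (fun j => X j ω) N * lengthScale N ^ 2 : ℝ) : EReal)) atTop ≤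
        limsup (fun N : ℕ =>
          ((groundEnergy (fun j => X j ω) N * lengthScale N ^ 2 : ℝ) : EReal)) atTop ∧
      limsup (fun N : ℕ =>
        ((groundEnergy (fun j => X j ω) N * lengthScale N ^ 2 : ℝ) : EReal)) atTop ≤
        ((Real.pi ^ 2 : ℝ) : EReal)) ∧
    (∀ᵐ ω ∂P,
      (1 : EReal) ≤ liminf (fun N : ℕ =>
        ((groundEnergy (fun j => X j ω) N * ‖landscape (fun j => X j ω) N‖ : ℝ) : EReal)) atTop ∧
      liminf (fun N : ℕ =>
        ((groundEnergy (fun j => X j ω) N * ‖landscape (fun j => X j ω) N‖ : ℝ) : EReal)) atTop ≤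
        limsup (fun N : ℕ =>
          ((groundEnergy (fun j => X j ω) N * ‖landscape (fun j => X j ω) N‖ : ℝ) : EReal))
          atTop ∧
      limsup (fun N : ℕ =>
        ((groundEnergy (fun j => X j ω) N * ‖landscape (fun j => X j ω) N‖ : ℝ) : EReal)) atTop ≤
        ((Real.pi ^ 2 / 8 : ℝ) : EReal)) := by
  -- A countable sequence of `ε` below `1/2`, so that one null set serves all of them.
  set e : ℕ → ℝ := fun k => 1 / ((k + 2 : ℕ) + 1 : ℝ)
  have he0 : ∀ k, 0 < e k := fun k => by positivity
  have he1 : ∀ k, e k < 1 / 2 := fun k => by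
    refine one_div_lt_one_div_of_lt two_pos ?_
    push_cast
    linarith [(Nat.cast_nonneg k : (0 : ℝ) ≤ k)]
  have he : Tendsto e atTop (𝓝 0) :=
    tendsto_one_div_add_atTop_nhds_zero_nat.comp (tendsto_add_atTop_nat 2)
  have hF : Tendsto (fun k => (5 * e k + (1 + 2 * e k) ^ 2 / 8) / (1 - 2 * e k)) atTop
      (𝓝 (1 / 8)) := by
    have : ContinuousAt (fun x : ℝ => (5 * x + (1 + 2 * x) ^ 2 / 8) / (1 - 2 * x)) 0 := by
      fun_prop (disch := norm_num)
    have h := this.tendsto.comp he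
    norm_num at h
    simpa [Function.comp_def] using h
  have hG : Tendsto (fun k => ((1 - 2 * e k) ^ 2 - e k) / (8 * (1 + e k / 4))) atTop
      (𝓝 (1 / 8)) := by
    have : ContinuousAt (fun x : ℝ => ((1 - 2 * x) ^ 2 - x) / (8 * (1 + x / 4))) 0 := by
      fun_prop (disch := norm_num)
    have h := this.tendsto.comp he
    norm_num at h
    simpa [Function.comp_def] using h
  have hE : Tendsto (fun k => Real.pi ^ 2 / (1 - 2 * e k) ^ 2 + 2 * e k) atTop
      (𝓝 (Real.pi ^ 2)) := by
    have : ContinuousAt (fun x : ℝ => Real.pi ^ 2 / (1 - 2 * x) ^ 2 + 2 * x) 0 := by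
      fun_prop (disch := norm_num)
    have h := this.tendsto.comp he
    norm_num at h
    simpa [Function.comp_def] using h
  have hae := ae_all_iff.2 fun k =>
    ae_eventually_bounds P a ha0 ha1 X hmeas hindep hunif (he0 k) (he1 k)
  have hlim : ∀ᵐ ω ∂P, Tendsto
      (fun N : ℕ => ‖landscape (fun j => X j ω) N‖ / lengthScale N ^ 2) atTop (𝓝 (1 / 8)) := by
    filter_upwards [hae] with ω hω
    refine tendsto_order.2 ⟨fun c hc => ?_, fun c hc => ?_⟩
    · obtain ⟨k, hk⟩ := (hG.eventually_const_lt hc).exists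
      filter_upwards [hω k] with N hN using hk.trans_le hN.2.2.1
    · obtain ⟨k, hk⟩ := (hF.eventually_lt_const hc).exists
      filter_upwards [hω k] with N hN using hN.2.1.trans_lt hk
  refine ⟨hlim, ?_, ?_⟩
  · filter_upwards [hae, hlim] with ω hω hl
    refine ⟨?_, liminf_le_limsup, ?_⟩
    · have h1 : Tendsto (fun N : ℕ =>
          (((‖landscape (fun j => X j ω) N‖ / lengthScale N ^ 2)⁻¹ : ℝ) : EReal)) atTop
          (𝓝 ((8 : ℝ) : EReal)) := by
        have h2 := hl.inv₀ (by norm_num)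
        norm_num at h2
        exact (continuous_coe_real_ereal.tendsto _).comp (by simpa using h2)
      have h3 : (8 : EReal) = ((8 : ℝ) : EReal) := rfl
      rw [h3, ← h1.liminf_eq]
      refine liminf_le_liminf ?_
      filter_upwards [hω 0] with N hN
      obtain ⟨⟨hT, hlam, hone⟩, -⟩ := hN
      rw [EReal.coe_le_coe_iff, inv_div]
      have hM : 0 < ‖landscape (fun j => X j ω) N‖ := by
        by_contra! hc
        nlinarith
      rw [div_le_iff₀ hM]
      nlinarith [sq_nonneg (lengthScale N)]
    · refine ge_of_tendsto' ((continuous_coe_real_ereal.tendsto _).comp hE) fun k => ?_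
      refine limsup_le_of_le (h := ?_)
      filter_upwards [hω k] with N hN
      exact EReal.coe_le_coe_iff.2 hN.2.2.2
  · filter_upwards [hae] with ω hω
    refine ⟨?_, liminf_le_limsup, ?_⟩
    · refine le_liminf_of_le (h := ?_)
      filter_upwards [hω 0] with N hN
      exact_mod_cast hN.1.2.2
    -- Factor `λ ‖u‖ = (λ T ^ 2) (‖u‖ / T ^ 2)` and bound each factor for the same `ε`.
    · have hEF := hE.mul hF
      rw [mul_one_div] at hEF
      refine ge_of_tendsto' ((continuous_coe_real_ereal.tendsto _).comp hEF) fun k => ?_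
      refine limsup_le_of_le (h := ?_)
      filter_upwards [hω k] with N hN
      obtain ⟨⟨hT, hlam, hone⟩, h1, -, h2⟩ := hN
      refine EReal.coe_le_coe_iff.2 ?_
      have h3 := mul_le_mul h2 h1 (by positivity) ((by positivity : (0 : ℝ) ≤ _).trans h2)
      refine le_trans (le_of_eq ?_) h3
      field_simp
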